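/- Let $N\ge 1$ and $d$ be integers, $f_1,\dots,f_N:\mathbb R^d\to\mathbb R$, $f=\sum_i f_i$; $|\cdot|$ is the Euclidean norm. For $\boldsymbol\theta=(\theta_1,\dots,\theta_N)\in\mathbb R^{dN}$ put $\langle\boldsymbol\theta\rangle=\frac1N\sum_i\theta_i$, $\mathbb 1\otimes\theta=(\theta,\dots,\theta)$ and $J^\perp\boldsymbol\theta=\boldsymbol\theta-\mathbb 1\otimes\langle\boldsymbol\theta\rangle$. Let $\boldsymbol\theta_0$ and $Y_n$ ($n\ge1$) be random vectors in $\mathbb R^{dN}$, $W_n$ ($n\ge1$) random real $N\times N$ matrices, $(\gamma_n)_{n\ge1}$ a deterministic real sequence, and $$\boldsymbol\theta_n=(W_n\otimes I_d)(\boldsymbol\theta_{n-1}+\gamma_nY_n),\qquad n\ge1,$$ $\mathcal F_n=\sigma(\boldsymbol\theta_0,Y_1,\dots,Y_n,W_1,\dots,W_n)$ for $n\ge0$. Let $(\mu_{\boldsymbol\theta})$ be a measurable family of probability measures on $\mathbb R^{dN}$ and $\mathbb E_{\boldsymbol\theta}[g(Y)]=\int g\,d\mu_{\boldsymbol\theta}$.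 Let $\rho_n$ be the spectral radius of $\mathbb E(W_nW_n^T)-\mathbb 1\mathbb 1^T/N$. Assume: **A1.** (a) $W_n\mathbb 1=W_n^T\mathbb 1=\mathbb 1$ almost surely. (b) $W_n$ is square-integrable and $n(1-\rho_n)\to+\infty$. (c) For all $n\ge0$ and all measurable $g_1,g_2\ge0$, $\mathbb E[g_1(W_{n+1})g_2(Y_{n+1})\mid\mathcal F_n]=\mathbb E[g_1(W_{n+1})]\,\mathbb E_{\boldsymbol\theta_n}[g_2(Y)]$ (in particular $Y_{n+1}$ has law $\mu_{\boldsymbol\theta_n}$ given $\mathcal F_n$). (d) $\mathbb E|\boldsymbol\theta_0|^2<\infty$. (e) Each $f_i$ is continuously differentiable. (f) For every $\boldsymbol\theta$, $\mathbb E_{\boldsymbol\theta}[Y]$ exists and equals $-(\nabla f_1(\theta_1),\dots,\nabla f_N(\theta_N))$. **A2.** $\gamma_n>0$, $\sum_n\gamma_n=\infty$, and there is $\alpha>1/2$ with $n^\alpha\gamma_n\to0$ and $\liminf_n\frac{1-\rho_n}{n^\alpha\gamma_n}>0$. **A3.** $V:\mathbb R^d\to[0,\infty)$ is differentiable with Lipschitz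 gradient; $-\nabla V(\theta)^T\nabla f(\theta)\le0$ for all $\theta$; for some constant $C_1$, $|\nabla V(\theta)|^2\le C_1(1+V(\theta))$ for all $\theta$; $\{V\le M\}$ is compact for every $M>0$; the set $\mathcal L=\{\theta:\nabla V(\theta)^T\nabla f(\theta)=0\}$ is bounded; and $V(\mathcal L)$ has empty interior. **A4.** There is a constant $C_2$ such that for every $\boldsymbol\theta\in\mathbb R^{dN}$, $\mathbb E_{\boldsymbol\theta}[|Y|^2]\le C_2\left(1+V(\langle\boldsymbol\theta\rangle)+|J^\perp\boldsymbol\theta|^2\right)$ and $\left|\frac1N\nabla f(\langle\boldsymbol\theta\rangle)-\frac1N\sum_i\nabla f_i(\theta_i)\right|\le C_2|J^\perp\boldsymbol\theta|$. Then, almost surely, $\lim_{n\to\infty}\mathsf d(\boldsymbol\theta_n,\mathbb 1\otimes\mathcal L)=0$, where $\mathbb 1\otimes\mathcal L=\{\mathbb 1\otimes\theta:\theta\in\mathcal L\}$ and $\mathsf d(x,A)=\inf_{a\in A}|x-a|$. Moreover, almost surely, $\langle\boldsymbol\theta_n\rangle$ converges to a connected component of $\mathcal L$, that is, there is a (possibly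 random) connected component $C$ of $\mathcal L$ with $\mathsf d(\langle\boldsymbol\theta_n\rangle,C)\to0$. -/

import Mathlib

open MeasureTheory ProbabilityTheory Filter Topology Matrix
open scoped ENNReal NNReal Gradient

namespace DistributedSA

/-- The parameter space `ℝ^d` with its Euclidean norm. -/
abbrev Vec (d : ℕ) : Type := EuclideanSpace ℝ (Fin d)

/-- The space `ℝ^{dN}` of stacked vectors `(θ_1, …, θ_N)`, `θ_i ∈ ℝ^d`, with its Euclidean norm. -/
abbrev Stack (N d : ℕ) : Type := PiLp 2 (fun _ : Fin N => Vec d)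

section Algebra

variable {N d : ℕ}

/-- The consensus vector `𝟙 ⊗ θ`. -/
noncomputable def consensus (N : ℕ) {d : ℕ} (θ : Vec d) : Stack N d :=
  WithLp.toLp 2 (fun _ => θ)

/-- The network average `⟨θ⟩ = (θ_1 + ⋯ + θ_N) / N`. -/
noncomputable def avg (x : Stack N d) : Vec d :=
  (N : ℝ)⁻¹ • ∑ i, x i

/-- The disagreement vector `J^⊥ θ = θ - 𝟙 ⊗ ⟨θ⟩`. -/
noncomputable def disagreement (x : Stack N d) : Stack N d :=
  x - consensus N (avg x)

/-- The gossip map `(W ⊗ I_d) θ`, whose `i`-th block is `∑_j w(i,j) θ_j`. -/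
noncomputable def gossip (W : Matrix (Fin N) (Fin N) ℝ) (x : Stack N d) : Stack N d :=
  WithLp.toLp 2 (fun i => ∑ j, W i j • x j)

/-- The aggregate utility `f = ∑_i f_i`. -/
noncomputable def aggregate (f : Fin N → Vec d → ℝ) (θ : Vec d) : ℝ :=
  ∑ i, f i θ

/-- The set `{θ : ∇V(θ)ᵀ ∇F(θ) = 0}`. -/
def criticalSet (V F : Vec d → ℝ) : Set (Vec d) :=
  {θ | inner ℝ (∇ V θ) (∇ F θ) = 0}

end Algebra

section Model

/-- The product σ-field on matrices. -/
instance matrixMeasurableSpace (N : ℕ) : MeasurableSpace (Matrix (Fin N) (Fin N) ℝ) :=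
  inferInstanceAs (MeasurableSpace (Fin N → Fin N → ℝ))

variable {Ω : Type*} {N d : ℕ}

/-- The unconstrained algorithm `θ_n = (W_n ⊗ I_d)(θ_{n-1} + γ_n Y_n)`, started at `θ_0`.
The values `γ 0`, `W 0`, `Y 0` are not used. -/
noncomputable def iterates (γ : ℕ → ℝ) (W : ℕ → Ω → Matrix (Fin N) (Fin N) ℝ)
    (Y : ℕ → Ω → Stack N d) (θ₀ : Ω → Stack N d) : ℕ → Ω → Stack N d
  | 0 => θ₀
  | n + 1 => fun ω =>
      gossip (W (n + 1) ω) (iterates γ W Y θ₀ n ω + γ (n + 1) • Y (n + 1) ω)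

/-- The σ-field `F_n = σ(θ_0, Y_1, …, Y_n, W_1, …, W_n)`; in particular `F_0 = σ(θ_0)`. -/
@[reducible] def history (W : ℕ → Ω → Matrix (Fin N) (Fin N) ℝ) (Y : ℕ → Ω → Stack N d)
    (θ₀ : Ω → Stack N d) (n : ℕ) : MeasurableSpace Ω :=
  MeasurableSpace.comap θ₀ inferInstance ⊔
    ⨆ k ∈ Finset.Icc 1 n,
      (MeasurableSpace.comap (Y k) inferInstance ⊔ MeasurableSpace.comap (W k) inferInstance)

/-- `ρ_n`, the spectral radius of `E[W_n W_nᵀ] - 𝟙𝟙ᵀ/N`. This matrix is real symmetric, so that its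
spectrum is its real spectrum. -/
noncomputable def rho [MeasurableSpace Ω] (P : Measure Ω)
    (W : ℕ → Ω → Matrix (Fin N) (Fin N) ℝ) (n : ℕ) : ℝ :=
  (spectralRadius ℝ
    ((Matrix.of fun i j => ∫ ω, (W n ω * (W n ω)ᵀ) i j ∂P) -
      (N : ℝ)⁻¹ • (Matrix.of fun _ _ => 1) : Matrix (Fin N) (Fin N) ℝ)).toReal

/-- Observation and network model. -/
structure ObservationModel [MeasurableSpace Ω] (P : Measure Ω) (f : Fin N → Vec d → ℝ)
    (μ : Kernel (Stack N d) (Stack N d)) (γ : ℕ → ℝ) (W : ℕ → Ω → Matrix (Fin N) (Fin N) ℝ)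
    (Y : ℕ → Ω → Stack N d) (θ₀ : Ω → Stack N d) : Prop where
  measurable_W : ∀ n, 1 ≤ n → Measurable (W n)
  measurable_Y : ∀ n, 1 ≤ n → Measurable (Y n)
  measurable_init : Measurable θ₀
  /-- `W_n 𝟙 = W_nᵀ 𝟙 = 𝟙`. -/
  stochastic : ∀ n, 1 ≤ n → ∀ᵐ ω ∂P, W n ω *ᵥ 1 = 1 ∧ (W n ω)ᵀ *ᵥ 1 = 1
  squareIntegrable_W : ∀ n, 1 ≤ n → ∀ i j, MemLp (fun ω => W n ω i j) 2 P
  rho_tendsto : Tendsto (fun n : ℕ => (n : ℝ) * (1 - rho P W n)) atTop atTop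
  /-- `E[g₁(W_{n+1}) g₂(Y_{n+1}) | F_n] = E[g₁(W_{n+1})] E_{θ_n}[g₂(Y)]`; with `g₁ = 1` this says
  that the law of `Y_{n+1}` given `F_n` is `μ_{θ_n}`. -/
  condIndep : ∀ (n : ℕ) (g₁ : Matrix (Fin N) (Fin N) ℝ → ℝ≥0∞) (g₂ : Stack N d → ℝ≥0∞),
    Measurable g₁ → Measurable g₂ →
    P⁻[fun ω => g₁ (W (n + 1) ω) * g₂ (Y (n + 1) ω) | history W Y θ₀ n] =ᵐ[P]
      fun ω => (∫⁻ ω', g₁ (W (n + 1) ω') ∂P) * ∫⁻ y, g₂ y ∂(μ (iterates γ W Y θ₀ n ω))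
  squareIntegrable_init : MemLp θ₀ 2 P
  contDiff : ∀ i, ContDiff ℝ 1 (f i)
  /-- `E_θ[Y] = -(∇f_1(θ_1), …, ∇f_N(θ_N))`. -/
  mean : ∀ (x : Stack N d) (i : Fin N),
    Integrable (fun y : Stack N d => y i) (μ x) ∧ ∫ y, y i ∂(μ x) = -∇ (f i) (x i)

end Model

/-- Step sizes, relative to the spectral radii `ρ_n`. The lower limit is taken in the extended
reals, since it may be `+∞`. -/
structure StepSizes (γ ρ : ℕ → ℝ) : Prop where
  pos : ∀ n, 1 ≤ n → 0 < γ n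
  sum_tendsto : Tendsto (fun n => ∑ k ∈ Finset.Icc 1 n, γ k) atTop atTop
  rate : ∃ α : ℝ, 1 / 2 < α ∧
    Tendsto (fun n : ℕ => (n : ℝ) ^ α * γ n) atTop (𝓝 0) ∧
    0 < liminf (fun n : ℕ => (((1 - ρ n) / ((n : ℝ) ^ α * γ n) : ℝ) : EReal)) atTop

/-- `V` is a Lyapunov function for `-∇F`. -/
structure LyapunovConditions {d : ℕ} (V F : Vec d → ℝ) : Prop where
  nonneg : ∀ θ, 0 ≤ V θ
  differentiable : Differentiable ℝ V
  lipschitz_gradient : ∃ K : ℝ≥0, LipschitzWith K (∇ V)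
  descent : ∀ θ, -inner ℝ (∇ V θ) (∇ F θ) ≤ 0
  gradient_sq_le : ∃ C₁ : ℝ, ∀ θ, ‖∇ V θ‖ ^ 2 ≤ C₁ * (1 + V θ)
  isCompact_sublevel : ∀ M : ℝ, 0 < M → IsCompact {θ | V θ ≤ M}
  bounded : Bornology.IsBounded (criticalSet V F)
  interior_image : interior (V '' criticalSet V F) = ∅

/-- Growth and Lipschitz conditions. -/
def GrowthConditions {N d : ℕ} (f : Fin N → Vec d → ℝ) (V : Vec d → ℝ)
    (μ : Kernel (Stack N d) (Stack N d)) : Prop :=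
  ∃ C₂ : ℝ, ∀ x : Stack N d,
    (Integrable (fun y : Stack N d => ‖y‖ ^ 2) (μ x) ∧
      ∫ y, ‖y‖ ^ 2 ∂(μ x) ≤ C₂ * (1 + V (avg x) + ‖disagreement x‖ ^ 2)) ∧
    ‖(N : ℝ)⁻¹ • ∇ (aggregate f) (avg x) - (N : ℝ)⁻¹ • ∑ i, ∇ (f i) (x i)‖
      ≤ C₂ * ‖disagreement x‖

end DistributedSA

/-! Because `W_n` fixes `𝟙` on both sides, gossip leaves the average unchanged and commutes with
`J^⊥`. The averages therefore follow an Euler scheme for `-∇f/N`, perturbed by martingale noise and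
by a bias of norm at most a constant times `γ_n ‖J^⊥ θ_{n-1}‖`.

Neither the disagreement nor `v_n = E V(⟨θ_n⟩)` can be bounded without the other, so they are
estimated together. Let `a_n²` dominate the second moment of the disagreement in every direction
`u`, relative to `|u|²`. Independence of `W_{n+1}` from `(θ_n, Y_{n+1})` makes gossip contract this
quantity by `ρ_{n+1}`, and with `t_n = (n+1)^(-α)` one gets `a_{n+1} ≤ √ρ_{n+1} (a_n + C γ_{n+1} √(1
+ v_n + a_n²))` and `v_{n+1} ≤ v_n + C (t_n² (1 + v_n) + a_n²)`. Since `n (1 - ρ_n) → ∞`, the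
contraction beats the relative decay `α/n` of `t_n`; since `1 - ρ_n ≥ c n^α γ_n` eventually, it also
absorbs the forcing. Hence `a_n = O(t_n)` and `v_n` is bounded
(`exists_bound_of_coupled_recursion`), and `α > 1/2` makes `∑ t_n²` finite.

With these bounds the errors in the Lyapunov drift are summable in mean. Almost surely `V(⟨θ_n⟩)`
then converges, the series `∑ γ_{n+1} g(⟨θ_n⟩)` with `g = ∇V·∇f ≥ 0` is finite, `∑ ‖J^⊥ θ_n‖²` is
finite, the weighted martingale noise converges and the bias is absolutely summable.

The rest is pathwise. The averages stay in a compact sublevel set of `V`. Each time `g` is at least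
`ε` far along the path, it stays above `ε/2` for a fixed amount of time `∑ γ`, because the path
moves at bounded speed up to convergent noise; finiteness of the series thus forces `g(⟨θ_n⟩) → 0`
(`tendsto_zero_of_summable_along_scheme`). So all cluster points of the averages lie in `L`.
Increments vanish, so the cluster set is connected (`isPreconnected_mapClusterPt`) and lies in a
single component of `L`. -/

namespace DistributedSA

/-! ### Deterministic facts on perturbed Euler schemes and cluster sets. -/

section Deterministic

/-- A perturbed Euler scheme in a compact set along which the weighted sum of `g ≥ 0` is finite
satisfies `g (x n) → 0`. -/
theorem tendsto_zero_of_summable_along_scheme {E : Type*} [NormedAddCommGroup E] [NormedSpace ℝ E]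
    {x δ : ℕ → E} {γ : ℕ → ℝ} {h : E → E} {g : E → ℝ} {K : Set E}
    (hstep : ∀ n, x (n + 1) = x n + γ n • h (x n) + δ n) (hγ : ∀ n, 0 < γ n)
    (hsum : Tendsto (fun n => ∑ k ∈ Finset.range n, γ k) atTop atTop)
    (hδ : CauchySeq (fun n => ∑ k ∈ Finset.range n, δ k))
    (hh : Continuous h) (hg : Continuous g) (hg0 : ∀ y, 0 ≤ g y)
    (hgs : Summable fun n => γ n * g (x n)) (hK : IsCompact K) (hx : ∀ n, x n ∈ K) :
    Tendsto (fun n => g (x n)) atTop (𝓝 0) := by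
  obtain ⟨H, hH0, hH⟩ : ∃ H : ℝ, 0 < H ∧ ∀ y ∈ K, ‖h y‖ ≤ H := by
    obtain ⟨C, hC⟩ := hK.exists_bound_of_continuousOn hh.continuousOn
    exact ⟨max C 1, by positivity, fun y hy => (hC y hy).trans (le_max_left _ _)⟩
  have huc := hK.uniformContinuousOn_of_continuous hg.continuousOn
  rw [Metric.uniformContinuousOn_iff] at huc
  rw [Metric.tendsto_atTop]
  intro ε hε
  obtain ⟨r, hr, huc⟩ := huc (ε / 2) (by positivity)
  rw [Metric.cauchySeq_iff] at hδ
  obtain ⟨N₀, hN₀⟩ := hδ (r / 2) (by positivity)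
  have hc := hgs.hasSum.tendsto_sum_nat.cauchySeq
  rw [Metric.cauchySeq_iff] at hc
  obtain ⟨N₁, hN₁⟩ := hc (ε / 2 * (r / (2 * H))) (by positivity)
  refine ⟨max N₀ N₁, fun n hn => ?_⟩
  rw [Real.dist_eq, sub_zero, abs_of_nonneg (hg0 _)]
  by_contra! hcon
  have hn0 : N₀ ≤ n := (le_max_left _ _).trans hn
  have hn1 : N₁ ≤ n := (le_max_right _ _).trans hn
  -- At speed at most `H`, a time `r / (2H)` allows a displacement of at most `r / 2`. The least `m`
  -- exceeding this time is used: before `m` the path is still close to `x n`, while up to `m`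
  -- enough time has elapsed.
  have hex : ∃ m, n ≤ m ∧ r / (2 * H) < ∑ k ∈ Finset.Ico n m, γ k := by
    obtain ⟨m, hm, hm'⟩ := ((hsum.eventually_gt_atTop
      (r / (2 * H) + ∑ k ∈ Finset.range n, γ k)).and (eventually_ge_atTop n)).exists
    refine ⟨m, hm', ?_⟩
    rw [Finset.sum_Ico_eq_sub _ hm']
    linarith
  classical
  obtain ⟨hnm, hm⟩ := Nat.find_spec hex
  set m := Nat.find hex with hmdef
  have hmin : ∀ k, n ≤ k → k < m → ∑ j ∈ Finset.Ico n k, γ j ≤ r / (2 * H) := by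
    intro k hnk hkm
    have := Nat.find_min hex hkm
    push Not at this
    exact this hnk
  have hclose : ∀ k, n ≤ k → k < m → ε / 2 ≤ g (x k) := by
    intro k hnk hkm
    -- Once the accumulated noise is subtracted, only the drift moves the path; the noise
    -- contributes less than the other `r / 2`.
    set S : ℕ → E := fun n => ∑ k ∈ Finset.range n, δ k
    have h1 : dist (x n - S n) (x k - S k) ≤ ∑ j ∈ Finset.Ico n k, γ j * H := by
      refine dist_le_Ico_sum_of_dist_le (f := fun j => x j - S j) hnk (d := fun j => γ j * H) ?_
      intro j _ _
      have : x j - S j - (x (j + 1) - S (j + 1)) = -(γ j • h (x j)) := by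
        simp only [S, Finset.sum_range_succ, hstep]
        abel
      rw [dist_eq_norm, this, norm_neg, norm_smul, Real.norm_of_nonneg (hγ j).le]
      exact mul_le_mul_of_nonneg_left (hH _ (hx j)) (hγ j).le
    have h2 : ∑ j ∈ Finset.Ico n k, γ j * H ≤ r / 2 := by
      rw [← Finset.sum_mul]
      calc _ ≤ r / (2 * H) * H := mul_le_mul_of_nonneg_right (hmin k hnk hkm) hH0.le
        _ = r / 2 := by field_simp
    have h3 : dist (S n) (S k) < r / 2 := hN₀ n hn0 k (hn0.trans hnk)
    have h4 : dist (x n) (x k) < r := by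
      have : x n - x k = (x n - S n - (x k - S k)) + (S n - S k) := by abel
      rw [dist_eq_norm, this]
      refine (norm_add_le _ _).trans_lt ?_
      rw [dist_eq_norm] at h1 h3
      linarith
    have h5 := huc _ (hx n) _ (hx k) h4
    rw [Real.dist_eq] at h5
    have := (abs_lt.1 h5).2
    linarith
  have h6 := hN₁ m (hn1.trans hnm) n hn1
  rw [Real.dist_eq, ← Finset.sum_Ico_eq_sub _ hnm] at h6
  have h7 : ε / 2 * (r / (2 * H)) < ∑ k ∈ Finset.Ico n m, γ k * g (x k) := by
    calc ε / 2 * (r / (2 * H)) < ε / 2 * ∑ k ∈ Finset.Ico n m, γ k :=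
          mul_lt_mul_of_pos_left hm (by positivity)
      _ = ∑ k ∈ Finset.Ico n m, γ k * (ε / 2) := by rw [Finset.mul_sum]; simp only [mul_comm]
      _ ≤ _ := Finset.sum_le_sum fun k hk => by
          rw [Finset.mem_Ico] at hk
          exact mul_le_mul_of_nonneg_left (hclose k hk.1 hk.2) (hγ k).le
  exact absurd (h7.trans_le (le_abs_self _)) (not_lt.2 h6.le)

/-- By compactness, infinitely many terms at distance at least `ε` from `S` would have a cluster
point at distance at least `ε` from `S`, yet that point belongs to `S`. -/
theorem tendsto_infEDist_of_mapClusterPt {E : Type*} [PseudoMetricSpace E] {x : ℕ → E}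
    {K S : Set E} (hK : IsCompact K) (hx : ∀ n, x n ∈ K)
    (hS : ∀ p, MapClusterPt p atTop x → p ∈ S) :
    Tendsto (fun n => Metric.infEDist (x n) S) atTop (𝓝 0) := by
  rw [ENNReal.tendsto_nhds_zero]
  intro ε hε
  by_contra hcon
  rw [not_eventually] at hcon
  have hc : IsCompact (K ∩ {y | ε ≤ Metric.infEDist y S}) :=
    hK.inter_right (isClosed_le continuous_const Metric.continuous_infEDist)
  obtain ⟨p, hp, hp'⟩ := hc.exists_mapClusterPt_of_frequently
    (hcon.mono fun n hn => ⟨hx n, (not_le.1 hn).le⟩)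
  have h0 : Metric.infEDist p S = 0 := Metric.infEDist_zero_of_mem (hS p hp')
  have := hp.2
  rw [Set.mem_ofPred_eq, h0] at this
  exact absurd hε (not_lt.2 this)

/-- The cluster points of a relatively compact sequence with vanishing increments form a
preconnected set. -/
theorem isPreconnected_mapClusterPt {E : Type*} [MetricSpace E] {x : ℕ → E}
    {K : Set E} (hK : IsCompact K) (hx : ∀ n, x n ∈ K)
    (hstep : Tendsto (fun n => dist (x n) (x (n + 1))) atTop (𝓝 0)) :
    IsPreconnected {p | MapClusterPt p atTop x} := by
  have hclosed : IsClosed {p | MapClusterPt p atTop x} := isClosed_setOfPred_clusterPt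
  rw [isPreconnected_closed_iff]
  rintro A B hA hB hAB ⟨a, ha, haA⟩ ⟨b, hb, hbB⟩
  by_contra hemp
  have hA' := hclosed.inter hA
  have hB' := hclosed.inter hB
  set ω := {p | MapClusterPt p atTop x} with hω
  have hAne : (ω ∩ A).Nonempty := ⟨a, ha, haA⟩
  have hBne : (ω ∩ B).Nonempty := ⟨b, hb, hbB⟩
  -- A separating function: negative on `ω ∩ A`, positive on `ω ∩ B`, with no zero on `ω` when these
  -- closed sets are disjoint. The path changes the sign of `φ` infinitely often by vanishing jumps,
  -- which produces a cluster point where `φ = 0`.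
  set φ : E → ℝ := fun y => Metric.infDist y (ω ∩ A) - Metric.infDist y (ω ∩ B) with hφ
  have hφc : Continuous φ := (Metric.continuous_infDist_pt _).sub (Metric.continuous_infDist_pt _)
  have hdisj : ∀ p ∈ ω, φ p ≠ 0 := by
    intro p hp h0
    have h1 : Metric.infDist p (ω ∩ A) = Metric.infDist p (ω ∩ B) := sub_eq_zero.1 h0
    apply hemp
    rcases hAB hp with hpA | hpB
    · rw [Metric.infDist_zero_of_mem (s := ω ∩ A) ⟨hp, hpA⟩] at h1
      have := (hB'.mem_iff_infDist_zero hBne).2 h1.symm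
      exact ⟨p, hp, hpA, this.2⟩
    · rw [Metric.infDist_zero_of_mem (s := ω ∩ B) ⟨hp, hpB⟩] at h1
      have := (hA'.mem_iff_infDist_zero hAne).2 h1
      exact ⟨p, hp, this.2, hpB⟩
  have hneg : ∃ᶠ n in atTop, φ (x n) < 0 := by
    have h1 : φ a < 0 := by
      refine lt_of_le_of_ne ?_ (hdisj a ha)
      simp only [hφ, Metric.infDist_zero_of_mem (s := ω ∩ A) ⟨ha, haA⟩, zero_sub]
      exact neg_nonpos.2 Metric.infDist_nonneg
    exact ha.frequently (hφc.continuousAt.eventually (gt_mem_nhds h1))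
  have hpos : ∃ᶠ n in atTop, 0 < φ (x n) := by
    have h1 : 0 < φ b := by
      refine lt_of_le_of_ne ?_ (hdisj b hb).symm
      simp only [hφ, Metric.infDist_zero_of_mem (s := ω ∩ B) ⟨hb, hbB⟩, sub_zero]
      exact Metric.infDist_nonneg
    exact hb.frequently (hφc.continuousAt.eventually (lt_mem_nhds h1))
  have hjump : ∀ n, φ (x (n + 1)) ≤ φ (x n) + 2 * dist (x n) (x (n + 1)) := by
    intro n
    have h1 := Metric.infDist_le_infDist_add_dist (s := ω ∩ A) (x := x (n + 1)) (y := x n)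
    have h2 := Metric.infDist_le_infDist_add_dist (s := ω ∩ B) (x := x n) (y := x (n + 1))
    rw [dist_comm] at h1
    simp only [hφ]
    linarith
  have hfreq : ∀ k : ℕ, ∃ᶠ n in atTop, |φ (x n)| ≤ 1 / ((k : ℝ) + 1) := by
    intro k
    rw [frequently_atTop]
    intro M
    have hk : (0 : ℝ) < 1 / (k + 1) / 2 := by positivity
    obtain ⟨M', hM'⟩ := eventually_atTop.1 (hstep.eventually (gt_mem_nhds hk))
    obtain ⟨n, hn, hn'⟩ := (frequently_atTop.1 hneg) (max M M')
    have hex : ∃ j, n ≤ j ∧ 0 < φ (x j) := (frequently_atTop.1 hpos) n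
    classical
    -- At the first index after `n` where `φ` is positive, its value is at most the size of the last
    -- jump.
    obtain ⟨hj1, hj2⟩ := Nat.find_spec hex
    have hmin : ∀ i < Nat.find hex, n ≤ i → φ (x i) ≤ 0 := by
      intro i hi hni
      have := Nat.find_min hex hi
      push Not at this
      exact this hni
    generalize Nat.find hex = j at *
    have hnj : n < j := lt_of_le_of_ne hj1 (by rintro h; rw [← h] at hj2; linarith)
    obtain ⟨i, rfl⟩ : ∃ i, j = i + 1 := ⟨j - 1, by omega⟩
    refine ⟨i + 1, by omega, ?_⟩
    rw [abs_of_pos hj2]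
    have h1 := hmin i (by omega) (by omega)
    have h2 := hM' i (by omega)
    have h3 := hjump i
    linarith
  obtain ⟨σ, hσ, hσ'⟩ := extraction_forall_of_frequently hfreq
  obtain ⟨p, -, τ, hτ, hτ'⟩ := hK.tendsto_subseq (fun n => hx (σ n))
  have hpω : p ∈ ω := by
    have h1 : Tendsto (fun n => σ (τ n)) atTop atTop := hσ.tendsto_atTop.comp hτ.tendsto_atTop
    exact (Tendsto.mapClusterPt hτ').of_comp h1
  refine hdisj p hpω ?_
  have h1 : Tendsto (fun n => φ (x (σ (τ n)))) atTop (𝓝 (φ p)) := (hφc.tendsto p).comp hτ'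
  have h2 : Tendsto (fun n => φ (x (σ (τ n)))) atTop (𝓝 0) := by
    refine squeeze_zero_norm (a := fun n => 1 / ((τ n : ℝ) + 1)) (fun n => hσ' (τ n)) ?_
    exact tendsto_one_div_add_atTop_nhds_zero_nat.comp hτ.tendsto_atTop
  exact tendsto_nhds_unique h1 h2

/-- The cluster set is a preconnected subset of `L`, so the component of any one cluster point
contains all of them. -/
theorem exists_connectedComponentIn_tendsto {E : Type*} [MetricSpace E] {x : ℕ → E}
    {K L : Set E} (hK : IsCompact K) (hx : ∀ n, x n ∈ K)
    (hstep : Tendsto (fun n => dist (x n) (x (n + 1))) atTop (𝓝 0))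
    (hL : ∀ p, MapClusterPt p atTop x → p ∈ L) :
    ∃ θ ∈ L, Tendsto (fun n => Metric.infEDist (x n) (connectedComponentIn L θ)) atTop (𝓝 0) := by
  obtain ⟨θ, -, hθ⟩ := hK.exists_mapClusterPt_of_frequently (l := atTop) (f := x)
    (Eventually.of_forall hx).frequently
  refine ⟨θ, hL θ hθ, tendsto_infEDist_of_mapClusterPt hK hx fun p hp => ?_⟩
  exact (isPreconnected_mapClusterPt hK hx hstep).subset_connectedComponentIn
    (show θ ∈ {p | MapClusterPt p atTop x} from hθ) (fun q hq => hL q hq) hp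

/-- Second-order bound for a differentiable function with Lipschitz gradient. -/
theorem le_add_inner_gradient_add_sq {E : Type*} [NormedAddCommGroup E] [InnerProductSpace ℝ E]
    [CompleteSpace E] {V : E → ℝ} {K : ℝ≥0} (hV : Differentiable ℝ V) (hK : LipschitzWith K (∇ V))
    (x h : E) : V (x + h) ≤ V x + inner ℝ (∇ V x) h + K * ‖h‖ ^ 2 := by
  have hd : ∀ t : ℝ, HasDerivAt (fun t : ℝ => V (x + t • h)) (inner ℝ (∇ V (x + t • h)) h) t := by
    intro t
    have h1 : HasDerivAt (fun t : ℝ => x + t • h) h t := by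
      simpa using ((hasDerivAt_id t).smul_const h).const_add x
    have h2 := (hV (x + t • h)).hasGradientAt.hasFDerivAt.comp_hasDerivAt t h1
    simpa [Function.comp_def] using h2
  obtain ⟨t, ht, hmv⟩ := exists_hasDerivAt_eq_slope (fun t : ℝ => V (x + t • h)) _ zero_lt_one
    (fun t _ => (hd t).continuousAt.continuousWithinAt) (fun t _ => hd t)
  simp only [one_smul, zero_smul, add_zero, sub_zero, div_one] at hmv
  have h3 : inner ℝ (∇ V (x + t • h) - ∇ V x) h ≤ K * ‖h‖ ^ 2 := by
    refine (real_inner_le_norm _ _).trans ?_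
    have h4 := hK.dist_le_mul (x + t • h) x
    rw [dist_eq_norm, dist_eq_norm, add_sub_cancel_left, norm_smul,
      Real.norm_of_nonneg ht.1.le] at h4
    have h5 : t * ‖h‖ ≤ ‖h‖ := mul_le_of_le_one_left (norm_nonneg _) ht.2.le
    calc _ ≤ (K * ‖h‖) * ‖h‖ := by gcongr; exact h4.trans (by gcongr)
      _ = _ := by ring
  rw [inner_sub_left] at h3
  linarith

end Deterministic

/-! ### The coupled recursion for disagreement and Lyapunov moments. -/

section Recursion

/-- Combines `exp y ≥ 1 + y` with `log (1 + x) ≤ x`. One step costs the target rate a relative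
amount of at most `α / (n + 1)`, which the contraction must beat. -/
theorem rpow_neg_succ_ge {α : ℝ} (hα : 0 ≤ α) (n : ℕ) :
    ((n : ℝ) + 1) ^ (-α) * (1 - α / (n + 1)) ≤ ((n : ℝ) + 1 + 1) ^ (-α) := by
  have h0 : (0 : ℝ) < (n : ℝ) + 1 := by positivity
  have h1 : (n : ℝ) + 1 + 1 = (n + 1) * (1 + 1 / (n + 1)) := by field_simp
  have h2 : (0 : ℝ) < 1 + 1 / ((n : ℝ) + 1) := by positivity
  rw [h1, Real.mul_rpow h0.le h2.le]
  refine mul_le_mul_of_nonneg_left ?_ (by positivity)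
  rw [Real.rpow_def_of_pos h2]
  have h3 := Real.add_one_le_exp (Real.log (1 + 1 / ((n : ℝ) + 1)) * -α)
  have h4 := Real.log_le_sub_one_of_pos h2
  have h5 : Real.log (1 + 1 / ((n : ℝ) + 1)) * α ≤ 1 / ((n : ℝ) + 1) * α :=
    mul_le_mul_of_nonneg_right (by linarith) hα
  have h6 : α / ((n : ℝ) + 1) = 1 / ((n : ℝ) + 1) * α := by ring
  linarith

/-- The arithmetic of the induction step. The forcing inflates `B t s` by at most `1 + 3β/4`: `β/2`
comes from the part of `q` bounded by `s` and `β/4` from the part bounded by `a`. Then `(1 - β)(1 +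
3β/4) ≤ 1 - β/4 ≤ 1 - κ` leaves room for the decrease from `t` to `t'`. -/
theorem contraction_step {a s t t' γ β κ B C L q : ℝ} (hs : 0 ≤ s) (ht : 0 ≤ t)
    (hβ0 : 0 ≤ β) (hβ1 : 0 ≤ 1 - β) (hC : 0 ≤ C) (hB0 : 0 ≤ B)
    (hB : 2 * C * L ≤ B) (hCt : C * L * t ≤ 1 / 4) (hγ : γ ≤ L * β * t) (hγ0 : 0 ≤ γ)
    (hats : a ≤ B * t * s) (hq : q ≤ s + a) (hκ : κ ≤ β / 4) (htt : t * (1 - κ) ≤ t') :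
    (1 - β) * (a + C * γ * q) ≤ B * t' * s := by
  have h1 : C * γ * q ≤ C * (L * β * t) * (s + B * t * s) :=
    calc C * γ * q ≤ C * γ * (s + B * t * s) := by gcongr; linarith
      _ ≤ _ := by gcongr
  have h2 : C * L * t * (β * B * (t * s)) ≤ 1 / 4 * (β * B * (t * s)) :=
    mul_le_mul_of_nonneg_right hCt (by positivity)
  have h3 : 2 * C * L * (β * (t * s)) ≤ B * (β * (t * s)) :=
    mul_le_mul_of_nonneg_right hB (by positivity)
  have h4 : a + C * γ * q ≤ t * s * B * (1 + 3 / 4 * β) := by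
    calc a + C * γ * q ≤ B * t * s + C * (L * β * t) * (s + B * t * s) := add_le_add hats h1
      _ = B * t * s + 2 * C * L * (β * (t * s)) / 2 + C * L * t * (β * B * (t * s)) := by ring
      _ ≤ B * t * s + B * (β * (t * s)) / 2 + 1 / 4 * (β * B * (t * s)) := by gcongr
      _ = _ := by ring
  have h5 : (1 - β) * (1 + 3 / 4 * β) ≤ 1 - κ := by nlinarith [sq_nonneg β]
  calc (1 - β) * (a + C * γ * q) ≤ (1 - β) * (t * s * B * (1 + 3 / 4 * β)) := by gcongr
    _ = (t * s * B) * ((1 - β) * (1 + 3 / 4 * β)) := by ring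
    _ ≤ (t * s * B) * (1 - κ) := by gcongr
    _ = B * (t * (1 - κ)) * s := by ring
    _ ≤ B * t' * s := by gcongr

/-- A contraction `√ρ` that dominates the forcing `γ` makes `a` decay like `(n + 1) ^ (-α)` while
`v` stays bounded. -/
theorem exists_bound_of_coupled_recursion {a v γ ρ : ℕ → ℝ} {α C c : ℝ} (hα : 0 < α)
    (ha : ∀ n, 0 ≤ a n) (hv : ∀ n, 0 ≤ v n) (hγ : ∀ n, 0 < γ (n + 1)) (hρ : ∀ n, 0 ≤ ρ n)
    (hC : 0 ≤ C) (hc : 0 < c)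
    (hnρ : Tendsto (fun n : ℕ => (n : ℝ) * (1 - ρ n)) atTop atTop)
    (hcρ : ∀ᶠ n : ℕ in atTop, c * ((n : ℝ) ^ α * γ n) ≤ 1 - ρ n)
    (hra : ∀ n, a (n + 1) ≤ √(ρ (n + 1)) * (a n + C * γ (n + 1) * √(1 + v n + a n ^ 2)))
    (hrv : ∀ n, v (n + 1) ≤
      v n + C * ((((n : ℝ) + 1) ^ (-α)) ^ 2 * (1 + v n) + a n ^ 2))
    (hsum : Summable fun n : ℕ => (((n : ℝ) + 1) ^ (-α)) ^ 2) :
    ∃ K, ∀ n, v n ≤ K ∧ a n ≤ K * ((n : ℝ) + 1) ^ (-α) := by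
  set t : ℕ → ℝ := fun n => ((n : ℝ) + 1) ^ (-α) with ht
  have ht0 : ∀ n, 0 < t n := fun n => by positivity
  -- With `β = (1 - ρ)/2`, the bound `c n^α γ ≤ 1 - ρ` reads `γ ≤ (2/c) β t`.
  set L := 2 / c with hL
  have hL0 : 0 < L := by positivity
  have htt : Tendsto t atTop (𝓝 0) := by
    have := (tendsto_rpow_neg_atTop hα).comp tendsto_natCast_atTop_atTop
    have := this.comp (tendsto_add_atTop_nat 1)
    simpa [Function.comp_def, ht] using this
  have hev1 : ∀ᶠ n in atTop, C * L * t n ≤ 1 / 4 := by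
    have : Tendsto (fun n => C * L * t n) atTop (𝓝 (C * L * 0)) := htt.const_mul _
    rw [mul_zero] at this
    exact this.eventually_le_const (by norm_num)
  -- The factor 8 turns this into `α / (n + 1) ≤ β / 4`.
  have hev2 : ∀ᶠ n : ℕ in atTop, 8 * α ≤ ((n : ℝ) + 1) * (1 - ρ (n + 1)) := by
    have := (hnρ.comp (tendsto_add_atTop_nat 1)).eventually_ge_atTop (8 * α)
    simpa using this
  have hev3 : ∀ᶠ n : ℕ in atTop, γ (n + 1) ≤ L * ((1 - ρ (n + 1)) / 2) * t n := by
    filter_upwards [(tendsto_add_atTop_nat 1).eventually hcρ] with n hn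
    push_cast at hn
    have h1 : t n * ((n : ℝ) + 1) ^ α = 1 := by
      rw [ht]; simp only; rw [← Real.rpow_add (by positivity)]; simp
    have h2 := mul_le_mul_of_nonneg_left hn (ht0 n).le
    have h3 : t n * (c * (((n : ℝ) + 1) ^ α * γ (n + 1))) = c * γ (n + 1) := by
      linear_combination c * γ (n + 1) * h1
    rw [h3] at h2
    have h4 : L * ((1 - ρ (n + 1)) / 2) * t n = t n * (1 - ρ (n + 1)) / c := by
      rw [hL]; field_simp
    rw [h4, le_div_iff₀ hc]
    linarith
  obtain ⟨n₀, hn₀⟩ := eventually_atTop.1 (hev1.and (hev2.and hev3))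
  -- The first entry absorbs the forcing; the second starts the induction at `n₀`.
  set B := max (2 * C * L) (a n₀ / t n₀) with hB
  have hB1 : 2 * C * L ≤ B := le_max_left _ _
  have hB0 : 0 ≤ B := le_trans (by positivity) hB1
  set D := C * (1 + B ^ 2) with hD
  have hD0 : 0 ≤ D := by positivity
  -- A monotone majorant of `1 + v`. If `a ≤ B t √m`, the recursion multiplies `1 + v` by at most `1
  -- + D t²`, which the exponential dominates; summability of `t²` keeps `m` bounded. The factor
  -- `√m` in the bound on `a` lets both estimates close in one induction.
  set m : ℕ → ℝ := fun n => (1 + v n₀) * Real.exp (D * ∑ j ∈ Finset.range n, t j ^ 2) with hm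
  have hm1 : ∀ n, 1 ≤ m n := fun n => by
    have h1 : 1 ≤ Real.exp (D * ∑ j ∈ Finset.range n, t j ^ 2) :=
      Real.one_le_exp (by positivity)
    have := hv n₀
    simp only [hm]
    nlinarith
  have hmsucc : ∀ n, m n * (1 + D * t n ^ 2) ≤ m (n + 1) := fun n => by
    simp only [hm]
    rw [Finset.sum_range_succ, mul_add D, Real.exp_add, mul_assoc]
    have := hv n₀
    have := Real.add_one_le_exp (D * t n ^ 2)
    refine mul_le_mul_of_nonneg_left (mul_le_mul_of_nonneg_left ?_ (Real.exp_pos _).le) ?_ <;>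
      linarith
  have key : ∀ n, n₀ ≤ n → 1 + v n ≤ m n ∧ a n ≤ B * t n * √(m n) := by
    intro n hn
    induction n, hn using Nat.le_induction with
    | base =>
      constructor
      · have h1 : 1 ≤ Real.exp (D * ∑ j ∈ Finset.range n₀, t j ^ 2) :=
          Real.one_le_exp (by positivity)
        exact le_mul_of_one_le_right (by linarith [hv n₀]) h1
      · have h1 : a n₀ ≤ B * t n₀ := by
          rw [← div_le_iff₀ (ht0 _)]; exact le_max_right _ _
        refine h1.trans (le_mul_of_one_le_right (by have := ht0 n₀; positivity) ?_)
        exact Real.one_le_sqrt.2 (hm1 _)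
    | succ n hn ih =>
      obtain ⟨ihv, iha⟩ := ih
      obtain ⟨e1, e2, e3⟩ := hn₀ n hn
      have hms := hmsucc n
      have hmpos : 0 ≤ m n := by linarith [hm1 n]
      set s := √(m n) with hs
      have hs0 : 0 ≤ s := Real.sqrt_nonneg _
      have hss : s ^ 2 = m n := Real.sq_sqrt hmpos
      have hmono : m n ≤ m (n + 1) := by
        refine le_trans ?_ hms
        exact le_mul_of_one_le_right hmpos (by have := sq_nonneg (t n); nlinarith)
      have htn := ht0 n
      constructor
      · have h1 : a n ^ 2 ≤ B ^ 2 * t n ^ 2 * m n := by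
          calc a n ^ 2 ≤ (B * t n * s) ^ 2 := pow_le_pow_left₀ (ha n) iha 2
            _ = _ := by rw [mul_pow, mul_pow, hss]
        have h2 := hrv n
        have h3 : C * (t n ^ 2 * (1 + v n) + a n ^ 2) ≤
            C * (t n ^ 2 * m n + B ^ 2 * t n ^ 2 * m n) := by gcongr
        calc 1 + v (n + 1) ≤ m n + C * (t n ^ 2 * m n + B ^ 2 * t n ^ 2 * m n) := by linarith
          _ = m n * (1 + D * t n ^ 2) := by rw [hD]; ring
          _ ≤ _ := hms
      · set β := (1 - ρ (n + 1)) / 2 with hβ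
        have hn1 : (0 : ℝ) < (n : ℝ) + 1 := by positivity
        have hβα : α / (n + 1) ≤ β / 4 := by
          rw [div_le_iff₀ hn1, hβ]; linarith
        have hβ0 : 0 ≤ β := by
          have : 0 ≤ α / (n + 1) := by positivity
          linarith
        have hβ1 : 0 ≤ 1 - β := by have := hρ (n + 1); rw [hβ]; linarith
        -- Since `1 - β = (1 + ρ)/2`, this is the arithmetic-geometric inequality.
        have hsq : √(ρ (n + 1)) ≤ 1 - β := by
          rw [Real.sqrt_le_left hβ1, hβ]
          nlinarith [sq_nonneg (1 - ρ (n + 1))]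
        have hroot : √(1 + v n + a n ^ 2) ≤ s + a n := by
          rw [Real.sqrt_le_left (add_nonneg hs0 (ha n))]
          have := mul_nonneg hs0 (ha n)
          nlinarith
        have hγn := hγ n
        have h3 : t n * (1 - α / (n + 1)) ≤ t (n + 1) := by
          have := rpow_neg_succ_ge hα.le n
          simpa [ht] using this
        have h4 : s ≤ √(m (n + 1)) := Real.sqrt_le_sqrt hmono
        have h5 := contraction_step hs0 htn.le hβ0 hβ1 hC hB0 hB1 e1 e3 hγn.le iha hroot
          hβα h3
        have h6 : 0 ≤ a n + C * γ (n + 1) * √(1 + v n + a n ^ 2) := by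
          have := ha n
          positivity
        calc a (n + 1) ≤ (1 - β) * (a n + C * γ (n + 1) * √(1 + v n + a n ^ 2)) :=
              (hra n).trans (mul_le_mul_of_nonneg_right hsq h6)
          _ ≤ B * t (n + 1) * s := h5
          _ ≤ B * t (n + 1) * √(m (n + 1)) := by
            have := ht0 (n + 1)
            gcongr
  set M := (1 + v n₀) * Real.exp (D * ∑' j, t j ^ 2) with hM
  have hmM : ∀ n, m n ≤ M := fun n => by
    have := hv n₀
    simp only [hm, hM]
    gcongr
    exact hsum.sum_le_tsum _ (fun _ _ => sq_nonneg _)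
  have hM1 : 1 ≤ M := (hm1 0).trans (hmM 0)
  -- This accounts for the finitely many indices before `n₀`.
  set Q := ∑ n ∈ Finset.range n₀, (v n + a n / t n) with hQ
  have hterm : ∀ n, 0 ≤ v n + a n / t n := fun n => add_nonneg (hv n) (div_nonneg (ha n) (ht0 n).le)
  have hQ0 : 0 ≤ Q := Finset.sum_nonneg fun n _ => hterm n
  refine ⟨M + B * √M + Q, fun n => ?_⟩
  have hBM : 0 ≤ B * √M := by positivity
  rcases lt_or_ge n n₀ with hn | hn
  · have h1 : v n + a n / t n ≤ Q :=
      Finset.single_le_sum (f := fun n => v n + a n / t n) (fun n _ => hterm n)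
        (Finset.mem_range.2 hn)
    have h2 := div_nonneg (ha n) (ht0 n).le
    refine ⟨by linarith, ?_⟩
    rw [← div_le_iff₀ (ht0 n)]
    linarith [hv n]
  · obtain ⟨h1, h2⟩ := key n hn
    refine ⟨by linarith [hmM n], h2.trans ?_⟩
    have h3 : √(m n) ≤ √M := Real.sqrt_le_sqrt (hmM n)
    calc B * t n * √(m n) ≤ B * t n * √M := by have := ht0 n; gcongr
      _ = B * √M * t n := by ring
      _ ≤ _ := by have := ht0 n; gcongr; linarith

end Recursion

/-! ### Algebra of stacked vectors, averages and gossip. -/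

section StackAlgebra

variable {N d : ℕ}

theorem avg_add (x y : Stack N d) : avg (x + y) = avg x + avg y := by
  simp [avg, Finset.sum_add_distrib]

theorem avg_smul (c : ℝ) (x : Stack N d) : avg (c • x) = c • avg x := by
  simp only [avg, PiLp.smul_apply, ← Finset.smul_sum]
  rw [smul_comm]

theorem continuous_avg : Continuous (avg : Stack N d → Vec d) := by
  unfold avg
  fun_prop

theorem disagreement_apply (x : Stack N d) (i : Fin N) : disagreement x i = x i - avg x := rfl

theorem disagreement_add (x y : Stack N d) :
    disagreement (x + y) = disagreement x + disagreement y := by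
  ext1 i
  simp only [disagreement_apply, PiLp.add_apply, avg_add]
  abel

theorem disagreement_smul (c : ℝ) (x : Stack N d) :
    disagreement (c • x) = c • disagreement x := by
  ext1 i
  simp only [disagreement_apply, PiLp.smul_apply, avg_smul, smul_sub]

theorem continuous_disagreement : Continuous (disagreement : Stack N d → Stack N d) := by
  unfold disagreement consensus
  have := continuous_avg (N := N) (d := d)
  fun_prop

theorem sum_eq_smul_avg (hN : 1 ≤ N) (x : Stack N d) : ∑ i, x i = (N : ℝ) • avg x := by
  have : (N : ℝ) ≠ 0 := by positivity
  rw [avg, smul_smul, mul_inv_cancel₀ this, one_smul]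

theorem sum_disagreement (hN : 1 ≤ N) (x : Stack N d) : ∑ i, disagreement x i = 0 := by
  simp only [disagreement_apply, Finset.sum_sub_distrib, sum_eq_smul_avg hN, Finset.sum_const,
    Finset.card_univ, Fintype.card_fin, ← Nat.cast_smul_eq_nsmul ℝ, sub_self]

theorem norm_sq_eq_sum (x : Stack N d) : ‖x‖ ^ 2 = ∑ i, ‖x i‖ ^ 2 :=
  PiLp.norm_sq_eq_of_L2 _ x

theorem norm_avg_le (hN : 1 ≤ N) (x : Stack N d) : ‖avg x‖ ≤ ‖x‖ := by
  have hN' : (0 : ℝ) < N := by positivity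
  rw [avg, norm_smul, norm_inv, Real.norm_natCast, inv_mul_le_iff₀ hN']
  refine (norm_sum_le _ _).trans ((Finset.sum_le_sum fun i _ => PiLp.norm_apply_le x i).trans ?_)
  simp

theorem norm_disagreement_le (hN : 1 ≤ N) (x : Stack N d) : ‖disagreement x‖ ≤ ‖x‖ := by
  rw [← sq_le_sq₀ (norm_nonneg _) (norm_nonneg _), norm_sq_eq_sum, norm_sq_eq_sum]
  simp only [disagreement_apply, norm_sub_sq_real, Finset.sum_add_distrib, Finset.sum_sub_distrib,
    ← Finset.mul_sum, ← sum_inner, sum_eq_smul_avg hN, real_inner_smul_left,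
    real_inner_self_eq_norm_sq, Finset.sum_const, Finset.card_univ, Fintype.card_fin, nsmul_eq_mul]
  have : 0 ≤ (N : ℝ) * ‖avg x‖ ^ 2 := by positivity
  linarith

/-- The combination `∑_j u_j x_j` of the blocks of a stacked vector. -/
noncomputable def blockSum (u : Fin N → ℝ) (x : Stack N d) : Vec d := ∑ j, u j • x j

theorem blockSum_add (u : Fin N → ℝ) (x y : Stack N d) :
    blockSum u (x + y) = blockSum u x + blockSum u y := by
  simp [blockSum, Finset.sum_add_distrib]

theorem blockSum_smul (u : Fin N → ℝ) (c : ℝ) (x : Stack N d) :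
    blockSum u (c • x) = c • blockSum u x := by
  simp only [blockSum, PiLp.smul_apply, Finset.smul_sum]
  exact Finset.sum_congr rfl fun j _ => smul_comm _ _ _

theorem continuous_blockSum (u : Fin N → ℝ) :
    Continuous (blockSum u : Stack N d → Vec d) := by
  unfold blockSum
  fun_prop

theorem norm_blockSum_sq_le (u : Fin N → ℝ) (x : Stack N d) :
    ‖blockSum u x‖ ^ 2 ≤ (u ⬝ᵥ u) * ‖x‖ ^ 2 := by
  have h1 : ‖blockSum u x‖ ≤ ∑ j, |u j| * ‖x j‖ := by
    refine (norm_sum_le _ _).trans_eq ?_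
    simp [norm_smul]
  calc ‖blockSum u x‖ ^ 2 ≤ (∑ j, |u j| * ‖x j‖) ^ 2 := pow_le_pow_left₀ (norm_nonneg _) h1 2
    _ ≤ (∑ j, |u j| ^ 2) * ∑ j, ‖x j‖ ^ 2 := Finset.sum_mul_sq_le_sq_mul_sq _ _ _
    _ = _ := by rw [norm_sq_eq_sum]; simp [dotProduct, sq]

theorem norm_sq_eq_sum_blockSum (x : Stack N d) :
    ‖x‖ ^ 2 = ∑ i, ‖blockSum (Pi.single i 1) x‖ ^ 2 := by
  rw [norm_sq_eq_sum]
  simp [blockSum, Pi.single_apply, ite_smul]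

theorem blockSum_gossip (u : Fin N → ℝ) (W : Matrix (Fin N) (Fin N) ℝ) (x : Stack N d) :
    blockSum u (gossip W x) = blockSum (u ᵥ* W) x := by
  simp only [blockSum, gossip, Matrix.vecMul, dotProduct, Finset.smul_sum, Finset.sum_smul,
    smul_smul]
  exact Finset.sum_comm

theorem avg_eq_blockSum (x : Stack N d) : avg x = (N : ℝ)⁻¹ • blockSum 1 x := by
  simp [avg, blockSum]

theorem avg_gossip {W : Matrix (Fin N) (Fin N) ℝ} (hW : Wᵀ *ᵥ 1 = 1) (x : Stack N d) :
    avg (gossip W x) = avg x := by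
  rw [avg_eq_blockSum, blockSum_gossip, ← Matrix.mulVec_transpose, hW, ← avg_eq_blockSum]

theorem disagreement_gossip {W : Matrix (Fin N) (Fin N) ℝ} (hW : W *ᵥ 1 = 1)
    (hW' : Wᵀ *ᵥ 1 = 1) (x : Stack N d) :
    disagreement (gossip W x) = gossip W (disagreement x) := by
  ext1 i
  have h1 : ∑ j, W i j = 1 := by simpa [Matrix.mulVec, dotProduct] using congrFun hW i
  rw [disagreement_apply, avg_gossip hW']
  simp only [gossip, disagreement_apply, smul_sub, Finset.sum_sub_distrib,
    ← Finset.sum_smul, h1, one_smul]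

theorem norm_gossip_sq_le (W : Matrix (Fin N) (Fin N) ℝ) (x : Stack N d) :
    ‖gossip W x‖ ^ 2 ≤ (∑ i, ∑ j, W i j ^ 2) * ‖x‖ ^ 2 := by
  rw [norm_sq_eq_sum, Finset.sum_mul]
  refine Finset.sum_le_sum fun i _ => ?_
  have := norm_blockSum_sq_le (W i) x
  simpa [dotProduct, sq, blockSum, gossip] using this

/-- Directions tested against a disagreement vector may be centred for free; this is how `𝟙𝟙ᵀ/N`
gets subtracted from `E[W Wᵀ]`. -/
theorem blockSum_sub_const {x : Stack N d} (hx : ∑ i, x i = 0) (u : Fin N → ℝ) (c : ℝ) :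
    blockSum (fun j => u j - c) x = blockSum u x := by
  simp [blockSum, sub_smul, ← Finset.smul_sum, hx]

theorem dotProduct_sub_mean (hN : 1 ≤ N) (u : Fin N → ℝ) :
    (fun j => u j - (N : ℝ)⁻¹ * ∑ i, u i) ⬝ᵥ (fun j => u j - (N : ℝ)⁻¹ * ∑ i, u i) =
      u ⬝ᵥ u - (N : ℝ)⁻¹ * (∑ i, u i) ^ 2 := by
  have : (N : ℝ) ≠ 0 := by positivity
  simp only [dotProduct]
  have h : ∀ j, (u j - (N : ℝ)⁻¹ * ∑ i, u i) * (u j - (N : ℝ)⁻¹ * ∑ i, u i) =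
      u j * u j - 2 * ((N : ℝ)⁻¹ * ∑ i, u i) * u j + ((N : ℝ)⁻¹ * ∑ i, u i) ^ 2 := by
    intro j; ring
  simp only [h, Finset.sum_add_distrib, Finset.sum_sub_distrib, ← Finset.mul_sum, Finset.sum_const,
    Finset.card_univ, Fintype.card_fin, nsmul_eq_mul]
  field_simp
  ring

theorem measurable_matrix_apply (i j : Fin N) :
    Measurable fun W : Matrix (Fin N) (Fin N) ℝ => W i j :=
  (measurable_pi_apply j).comp (measurable_pi_apply (X := fun _ : Fin N => Fin N → ℝ) i)

theorem measurable_gossip :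
    Measurable fun p : Matrix (Fin N) (Fin N) ℝ × Stack N d => gossip p.1 p.2 := by
  unfold gossip
  refine (WithLp.measurable_toLp 2 _).comp (measurable_pi_lambda _ fun i => ?_)
  refine Finset.measurable_sum _ fun j _ => ?_
  have h1 : Measurable fun p : Matrix (Fin N) (Fin N) ℝ × Stack N d => p.1 i j :=
    (measurable_matrix_apply i j).comp measurable_fst
  have h2 : Measurable fun p : Matrix (Fin N) (Fin N) ℝ × Stack N d => p.2 j :=
    (PiLp.continuous_apply 2 (fun _ : Fin N => Vec d) j).measurable.comp measurable_snd
  exact h1.smul h2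

end StackAlgebra

/-! ### Quadratic forms and the spectral radius. -/

section SpectralRadius

/-- The quadratic form of a real symmetric matrix is bounded by its spectral radius. -/
theorem dotProduct_mulVec_le_spectralRadius {n : Type*} [Fintype n] [DecidableEq n]
    {M : Matrix n n ℝ} (hM : M.IsHermitian) (u : n → ℝ) :
    u ⬝ᵥ (M *ᵥ u) ≤ (spectralRadius ℝ M).toReal * (u ⬝ᵥ u) := by
  set r := (spectralRadius ℝ M).toReal with hr
  -- Finiteness matters because `toReal` sends `∞` to `0`.
  have hfin : spectralRadius ℝ M ≠ ∞ := by
    obtain ⟨b, hb⟩ := ((Matrix.finite_real_spectrum (A := M)).image (fun k : ℝ => ‖k‖₊)).bddAbove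
    have : spectralRadius ℝ M ≤ b :=
      iSup₂_le fun k hk => ENNReal.coe_le_coe.2 (hb ⟨k, hk, rfl⟩)
    exact ne_top_of_le_ne_top ENNReal.coe_ne_top this
  have hle : ∀ k ∈ spectrum ℝ M, |k| ≤ r := by
    intro k hk
    have h1 : (‖k‖₊ : ℝ≥0∞) ≤ spectralRadius ℝ M :=
      le_iSup₂ (f := fun (k : ℝ) (_ : k ∈ spectrum ℝ M) => (‖k‖₊ : ℝ≥0∞)) k hk
    have := ENNReal.toReal_mono hfin h1
    simpa using this
  -- The matrix `r I - M` is symmetric with spectrum `r - σ(M) ≥ 0`, hence positive semidefinite.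
  have hH : (algebraMap ℝ (Matrix n n ℝ) r - M).IsHermitian := by
    refine Matrix.IsHermitian.sub ?_ hM
    rw [Matrix.algebraMap_eq_diagonal]
    exact Matrix.isHermitian_diagonal _
  have hpsd : (algebraMap ℝ (Matrix n n ℝ) r - M).PosSemidef := by
    rw [hH.posSemidef_iff_eigenvalues_nonneg]
    intro i
    have h1 := hH.eigenvalues_mem_spectrum_real i
    rw [← spectrum.singleton_sub_eq] at h1
    obtain ⟨a, ha, b, hb, hab⟩ := Set.mem_sub.1 h1
    rw [Set.mem_singleton_iff] at ha
    have h2 := (abs_le.1 (hle b hb)).2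
    have h3 : (0 : ℝ) ≤ hH.eigenvalues i := by linarith
    exact h3
  have h := hpsd.dotProduct_mulVec_nonneg u
  simp only [star_trivial, Matrix.sub_mulVec, dotProduct_sub] at h
  have h2 : algebraMap ℝ (Matrix n n ℝ) r *ᵥ u = r • u := by
    rw [Algebra.algebraMap_eq_smul_one, Matrix.smul_mulVec, Matrix.one_mulVec]
  rw [h2, dotProduct_smul, smul_eq_mul] at h
  linarith

end SpectralRadius

/-! ### The filtration, independence, and disintegration along `μ`. -/

section History

variable {Ω : Type*} {N d : ℕ} {γ : ℕ → ℝ}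
  {W : ℕ → Ω → Matrix (Fin N) (Fin N) ℝ} {Y : ℕ → Ω → Stack N d} {θ₀ : Ω → Stack N d}

theorem history_mono {m n : ℕ} (h : m ≤ n) : history W Y θ₀ m ≤ history W Y θ₀ n := by
  refine sup_le_sup_left (biSup_mono fun k hk => ?_) _
  exact Finset.Icc_subset_Icc_right h hk

theorem comap_le_history (n : ℕ) :
    MeasurableSpace.comap (Y (n + 1)) inferInstance ⊔
      MeasurableSpace.comap (W (n + 1)) inferInstance ≤ history W Y θ₀ (n + 1) :=
  le_trans (le_iSup₂ (f := fun k (_ : k ∈ Finset.Icc 1 (n + 1)) =>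
    MeasurableSpace.comap (Y k) inferInstance ⊔ MeasurableSpace.comap (W k) inferInstance)
    (n + 1) (by simp)) le_sup_right

theorem measurable_observation_history (n : ℕ) :
    Measurable[history W Y θ₀ (n + 1)] (Y (n + 1)) :=
  (comap_measurable _).mono (le_sup_left.trans (comap_le_history n)) le_rfl

theorem measurable_iterates_history (n : ℕ) :
    Measurable[history W Y θ₀ n] (iterates γ W Y θ₀ n) := by
  induction n with
  | zero => exact (comap_measurable θ₀).mono le_sup_left le_rfl
  | succ n ih =>
    have h1 : Measurable[history W Y θ₀ (n + 1)] (iterates γ W Y θ₀ n) :=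
      ih.mono (history_mono n.le_succ) le_rfl
    have h2 := measurable_observation_history (W := W) (Y := Y) (θ₀ := θ₀) n
    have h3 : Measurable[history W Y θ₀ (n + 1)] (W (n + 1)) :=
      (comap_measurable _).mono (le_sup_right.trans (comap_le_history n)) le_rfl
    exact measurable_gossip.comp (h3.prodMk (h1.add (h2.const_smul (γ (n + 1)))))

variable [mΩ : MeasurableSpace Ω] {P : Measure Ω} {f : Fin N → Vec d → ℝ}
  {μ : Kernel (Stack N d) (Stack N d)}

theorem ObservationModel.history_le (hM : ObservationModel P f μ γ W Y θ₀) (n : ℕ) :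
    history W Y θ₀ n ≤ mΩ := by
  refine sup_le hM.measurable_init.comap_le (iSup₂_le fun k hk => ?_)
  rw [Finset.mem_Icc] at hk
  exact sup_le (hM.measurable_Y k hk.1).comap_le (hM.measurable_W k hk.1).comap_le

/-- The filtration `(F_n)`. -/
def ObservationModel.filtration (hM : ObservationModel P f μ γ W Y θ₀) : Filtration ℕ mΩ where
  seq := history W Y θ₀
  mono' _ _ h := history_mono h
  le' := hM.history_le

theorem ObservationModel.measurable_iterates (hM : ObservationModel P f μ γ W Y θ₀) (n : ℕ) :
    Measurable (iterates γ W Y θ₀ n) :=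
  (measurable_iterates_history n).mono (hM.history_le n) le_rfl

variable [IsProbabilityMeasure P]

/-- The conditional law tested on indicators. Rectangles form a π-system, so this one formula yields
both the independence of `W_{n+1}` and the disintegration of `(θ_n, Y_{n+1})`. -/
theorem ObservationModel.measure_inter (hM : ObservationModel P f μ γ W Y θ₀) (n : ℕ) {A : Set Ω}
    (hA : MeasurableSet[history W Y θ₀ n] A) {B : Set (Matrix (Fin N) (Fin N) ℝ)}
    (hB : MeasurableSet B) {C : Set (Stack N d)} (hC : MeasurableSet C) :
    P (A ∩ (W (n + 1) ⁻¹' B ∩ Y (n + 1) ⁻¹' C)) =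
      P (W (n + 1) ⁻¹' B) * ∫⁻ ω in A, μ (iterates γ W Y θ₀ n ω) C ∂P := by
  have hWm := hM.measurable_W (n + 1) (by omega)
  have hYm := hM.measurable_Y (n + 1) (by omega)
  have hAm := hM.history_le n _ hA
  have h := hM.condIndep n (B.indicator 1) (C.indicator 1) (measurable_one.indicator hB)
    (measurable_one.indicator hC)
  have h1 := setLIntegral_condLExp (hM.history_le n) P
    (fun ω => B.indicator 1 (W (n + 1) ω) * C.indicator 1 (Y (n + 1) ω)) hA
  rw [setLIntegral_congr_fun_ae hAm (h.mono fun ω hω _ => hω)] at h1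
  have h2 : ∀ ω, B.indicator (1 : Matrix (Fin N) (Fin N) ℝ → ℝ≥0∞) (W (n + 1) ω) *
      C.indicator (1 : Stack N d → ℝ≥0∞) (Y (n + 1) ω)
      = (W (n + 1) ⁻¹' B ∩ Y (n + 1) ⁻¹' C).indicator 1 ω := by
    intro ω
    rw [Set.inter_indicator_one]
    rfl
  have h3 : ∫⁻ ω', B.indicator (1 : Matrix (Fin N) (Fin N) ℝ → ℝ≥0∞) (W (n + 1) ω') ∂P =
      P (W (n + 1) ⁻¹' B) :=
    (lintegral_indicator_one (hWm hB))
  have hBC := (hWm hB).inter (hYm hC)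
  simp only [h2, h3, lintegral_indicator_one hC, lintegral_indicator_one hBC] at h1
  have h4 : Measurable fun ω => μ (iterates γ W Y θ₀ n ω) C :=
    (μ.measurable_coe hC).comp (hM.measurable_iterates n)
  rw [Measure.restrict_apply hBC, lintegral_const_mul _ h4, Set.inter_comm] at h1
  exact h1.symm

/-- `W_{n+1}` is independent of `(θ_n, Y_{n+1})`. -/
theorem ObservationModel.indepFun (hM : ObservationModel P f μ γ W Y θ₀) (n : ℕ) :
    IndepFun (W (n + 1)) (fun ω => (iterates γ W Y θ₀ n ω, Y (n + 1) ω)) P := by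
  have hXm := hM.measurable_iterates n
  have hWm := hM.measurable_W (n + 1) (by omega)
  have hYm := hM.measurable_Y (n + 1) (by omega)
  rw [indepFun_iff_map_prod_eq_prod_map_map hWm.aemeasurable (hXm.prodMk hYm).aemeasurable]
  have : IsProbabilityMeasure (P.map (W (n + 1))) :=
    Measure.isProbabilityMeasure_map hWm.aemeasurable
  have : IsProbabilityMeasure (P.map fun ω => (iterates γ W Y θ₀ n ω, Y (n + 1) ω)) :=
    Measure.isProbabilityMeasure_map (hXm.prodMk hYm).aemeasurable
  refine Measure.ext_prod₃ fun {s t u} hs ht hu => ?_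
  have hA : MeasurableSet[history W Y θ₀ n] (iterates γ W Y θ₀ n ⁻¹' t) :=
    measurable_iterates_history n ht
  have h := hM.measure_inter n hA hs hu
  -- Taking `B = univ` identifies the integral factor as the joint probability for `(θ_n, Y_{n+1})`.
  have h' := hM.measure_inter n hA MeasurableSet.univ hu
  simp only [Set.preimage_univ, measure_univ, one_mul, Set.univ_inter] at h'
  rw [Measure.map_apply (hWm.prodMk (hXm.prodMk hYm)) (hs.prod (ht.prod hu)),
    Measure.prod_prod, Measure.map_apply hWm hs,
    Measure.map_apply (hXm.prodMk hYm) (ht.prod hu)]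
  simp only [Set.mk_preimage_prod]
  rw [h', ← h, Set.inter_left_comm]

variable [IsMarkovKernel μ]

/-- On any event of `F_n`, the law of `(θ_n, Y_{n+1})` disintegrates along `μ`. -/
theorem ObservationModel.map_restrict (hM : ObservationModel P f μ γ W Y θ₀) (n : ℕ) {A : Set Ω}
    (hA : MeasurableSet[history W Y θ₀ n] A) :
    (P.restrict A).map (fun ω => (iterates γ W Y θ₀ n ω, Y (n + 1) ω)) =
      ((P.restrict A).map (iterates γ W Y θ₀ n)) ⊗ₘ μ := by
  have hXm := hM.measurable_iterates n
  have hYm := hM.measurable_Y (n + 1) (by omega)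
  refine Measure.ext_prod fun {s t} hs ht => ?_
  have hs' : MeasurableSet[history W Y θ₀ n] (A ∩ iterates γ W Y θ₀ n ⁻¹' s) :=
    hA.inter (measurable_iterates_history n hs)
  have h := hM.measure_inter n hs' MeasurableSet.univ ht
  rw [Measure.map_apply (hXm.prodMk hYm) (hs.prod ht), Set.mk_preimage_prod,
    Measure.restrict_apply ((hXm hs).inter (hYm ht)), Measure.compProd_apply_prod hs ht,
    Measure.restrict_map hXm hs, Measure.restrict_restrict (hXm hs),
    lintegral_map (μ.measurable_coe ht) hXm, ← Set.inter_comm A, ← Set.inter_comm A]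
  simp only [Set.preimage_univ, measure_univ, one_mul, Set.univ_inter] at h
  rw [← h, Set.inter_assoc]

/-- This is `E[ψ(θ_n, Y_{n+1}) | F_n] = ∫ ψ(θ_n, y) dμ_{θ_n}(y)`, tested on events of `F_n`; it
follows from Fubini for `⊗ₘ`. -/
theorem ObservationModel.integrable_condMean (hM : ObservationModel P f μ γ W Y θ₀)
    {E : Type*} [NormedAddCommGroup E] [NormedSpace ℝ E] (n : ℕ) {ψ : Stack N d × Stack N d → E}
    (hψ : StronglyMeasurable ψ)
    (hint : Integrable (fun ω => ψ (iterates γ W Y θ₀ n ω, Y (n + 1) ω)) P) :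
    Integrable (fun ω => ∫ y, ψ (iterates γ W Y θ₀ n ω, y) ∂μ (iterates γ W Y θ₀ n ω)) P ∧
    ∀ A, MeasurableSet[history W Y θ₀ n] A →
      ∫ ω in A, ψ (iterates γ W Y θ₀ n ω, Y (n + 1) ω) ∂P =
        ∫ ω in A, ∫ y, ψ (iterates γ W Y θ₀ n ω, y) ∂μ (iterates γ W Y θ₀ n ω) ∂P := by
  have hXm := hM.measurable_iterates n
  have hYm := hM.measurable_Y (n + 1) (by omega)
  have hXY := hXm.prodMk hYm
  have hmeas : StronglyMeasurable fun x => ∫ y, ψ (x, y) ∂μ x := hψ.integral_kernel_prod_right'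
  constructor
  · have h := hM.map_restrict n MeasurableSet.univ
    rw [Measure.restrict_univ] at h
    have h1 : Integrable ψ ((P.map (iterates γ W Y θ₀ n)) ⊗ₘ μ) := by
      rw [← h]
      exact (integrable_map_measure hψ.aestronglyMeasurable hXY.aemeasurable).2 hint
    exact (integrable_map_measure hmeas.aestronglyMeasurable hXm.aemeasurable).1
      (((Measure.integrable_compProd_iff hψ.aestronglyMeasurable).1 h1).2.mono'
        hmeas.aestronglyMeasurable (ae_of_all _ fun x => norm_integral_le_integral_norm _))
  · intro A hA
    have h := hM.map_restrict n hA
    have h1 : Integrable ψ (((P.restrict A).map (iterates γ W Y θ₀ n)) ⊗ₘ μ) := by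
      rw [← h]
      exact (integrable_map_measure hψ.aestronglyMeasurable hXY.aemeasurable).2 hint.integrableOn
    have h2 := Measure.integral_compProd h1
    rw [← h, integral_map hXY.aemeasurable hψ.aestronglyMeasurable,
      integral_map hXm.aemeasurable hmeas.aestronglyMeasurable] at h2
    exact h2

/-- A version free of integrability assumptions, from which square integrability of `Y_{n+1}` is
deduced. -/
theorem ObservationModel.lintegral_condMean (hM : ObservationModel P f μ γ W Y θ₀) (n : ℕ)
    {ψ : Stack N d → ℝ≥0∞} (hψ : Measurable ψ) :
    ∫⁻ ω, ψ (Y (n + 1) ω) ∂P = ∫⁻ ω, ∫⁻ y, ψ y ∂μ (iterates γ W Y θ₀ n ω) ∂P := by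
  have hXm := hM.measurable_iterates n
  have hYm := hM.measurable_Y (n + 1) (by omega)
  have h := hM.map_restrict n MeasurableSet.univ
  rw [Measure.restrict_univ] at h
  have h1 := Measure.lintegral_compProd (μ := P.map (iterates γ W Y θ₀ n)) (κ := μ)
    (f := fun p => ψ p.2) (hψ.comp measurable_snd)
  have h2 : Measurable fun p : Stack N d × Stack N d => ψ p.2 := hψ.comp measurable_snd
  rw [← h, lintegral_map h2 (hXm.prodMk hYm),
    lintegral_map (Measurable.lintegral_kernel hψ) hXm] at h1
  exact h1

end History

/-! ### One-step drift of the Lyapunov function. -/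

section Drift

variable {N d : ℕ} {f : Fin N → Vec d → ℝ} {μ : Kernel (Stack N d) (Stack N d)}
  {V : Vec d → ℝ}

theorem LyapunovConditions.continuous_gradient {F : Vec d → ℝ} (hV : LyapunovConditions V F) :
    Continuous (∇ V) := by
  obtain ⟨K, hK⟩ := hV.lipschitz_gradient
  exact hK.continuous

/-- A Lipschitz gradient allows at most quadratic growth, so `V(⟨X⟩)` is integrable for `X` in `L²`.
-/
theorem LyapunovConditions.exists_le_quadratic {F : Vec d → ℝ} (hV : LyapunovConditions V F) :
    ∃ A, 0 ≤ A ∧ ∀ θ, V θ ≤ A * (1 + ‖θ‖ ^ 2) := by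
  obtain ⟨K, hK⟩ := hV.lipschitz_gradient
  refine ⟨V 0 + ‖∇ V 0‖ + K, by have := hV.nonneg 0; positivity, fun θ => ?_⟩
  have h1 := le_add_inner_gradient_add_sq hV.differentiable hK 0 θ
  rw [zero_add] at h1
  have h2 := real_inner_le_norm (∇ V 0) θ
  have h3 : ‖∇ V 0‖ * ‖θ‖ ≤ ‖∇ V 0‖ * (1 + ‖θ‖ ^ 2) := by
    gcongr
    nlinarith [sq_nonneg (‖θ‖ - 1), norm_nonneg θ]
  have h4 : V 0 * 1 ≤ V 0 * (1 + ‖θ‖ ^ 2) :=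
    mul_le_mul_of_nonneg_left (by nlinarith [sq_nonneg ‖θ‖]) (hV.nonneg 0)
  have h5 : (0 : ℝ) ≤ K := K.2
  nlinarith

theorem GrowthConditions.exists_nonneg (hV0 : ∀ θ, 0 ≤ V θ) (h : GrowthConditions f V μ) :
    ∃ C, 0 ≤ C ∧ ∀ x : Stack N d,
      (Integrable (fun y : Stack N d => ‖y‖ ^ 2) (μ x) ∧
        ∫ y, ‖y‖ ^ 2 ∂(μ x) ≤ C * (1 + V (avg x) + ‖disagreement x‖ ^ 2)) ∧
      ‖(N : ℝ)⁻¹ • ∇ (aggregate f) (avg x) - (N : ℝ)⁻¹ • ∑ i, ∇ (f i) (x i)‖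
        ≤ C * ‖disagreement x‖ := by
  obtain ⟨C, hC⟩ := h
  refine ⟨max C 0, le_max_right _ _, fun x => ⟨⟨(hC x).1.1, (hC x).1.2.trans ?_⟩,
    (hC x).2.trans ?_⟩⟩
  · have := hV0 (avg x)
    gcongr
    exact le_max_left _ _
  · gcongr
    exact le_max_left _ _

/-- The mean `-N⁻¹ ∑_i ∇f_i(x_i)` of the averaged observation. -/
noncomputable def meanField (f : Fin N → Vec d → ℝ) (x : Stack N d) : Vec d :=
  -((N : ℝ)⁻¹ • ∑ i, ∇ (f i) (x i))

theorem integral_avg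
    (hmean : ∀ (x : Stack N d) (i : Fin N),
      Integrable (fun y : Stack N d => y i) (μ x) ∧ ∫ y, y i ∂(μ x) = -∇ (f i) (x i))
    (x : Stack N d) : Integrable (fun y => avg y) (μ x) ∧ ∫ y, avg y ∂μ x = meanField f x := by
  constructor
  · have h1 : Integrable (fun y : Stack N d => ∑ i, y i) (μ x) :=
      integrable_finsetSum _ fun i _ => (hmean x i).1
    exact h1.smul (N : ℝ)⁻¹
  · simp only [avg, integral_smul, meanField]
    rw [integral_finsetSum _ fun i _ => (hmean x i).1, ← smul_neg, ← Finset.sum_neg_distrib]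
    simp only [(hmean x _).2]

/-- One-step drift of the Lyapunov function along the network average. -/
theorem LyapunovConditions.exists_drift_le [IsMarkovKernel μ] (hN : 1 ≤ N)
    (hV : LyapunovConditions V (aggregate f)) (hGrowth : GrowthConditions f V μ)
    (hmean : ∀ (x : Stack N d) (i : Fin N),
      Integrable (fun y : Stack N d => y i) (μ x) ∧ ∫ y, y i ∂(μ x) = -∇ (f i) (x i))
    {G : ℝ} (hG : 0 ≤ G) :
    ∃ C, 0 ≤ C ∧ ∀ (x : Stack N d) (γ t : ℝ), 0 ≤ γ → γ ≤ G * t → 0 ≤ t → t ≤ 1 →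
      ∫ y, V (avg x + γ • avg y) ∂μ x ≤ V (avg x)
        - γ * ((N : ℝ)⁻¹ * inner ℝ (∇ V (avg x)) (∇ (aggregate f) (avg x)))
        + C * (t ^ 2 * (1 + V (avg x)) + ‖disagreement x‖ ^ 2) := by
  obtain ⟨C₂, hC₂, hg⟩ := hGrowth.exists_nonneg hV.nonneg
  obtain ⟨C₁, hC₁⟩ := hV.gradient_sq_le
  obtain ⟨K, hK⟩ := hV.lipschitz_gradient
  set C₁' := max C₁ 1 with hC₁'
  have hC₁0 : 1 ≤ C₁' := le_max_right _ _
  -- The first term pays for the bias paired with `∇V`, the second for the second-order Taylor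
  -- remainder.
  refine ⟨G * C₂ * C₁' + K * G ^ 2 * C₂, by positivity, fun x γ t hγ hγG ht ht1 => ?_⟩
  obtain ⟨⟨hy2, hy2'⟩, hr⟩ := hg x
  obtain ⟨hai, ham⟩ := integral_avg hmean x
  have hVx := hV.nonneg (avg x)
  set D := ‖disagreement x‖ with hD
  have hD0 : 0 ≤ D := norm_nonneg _
  set p := ∇ V (avg x) with hp
  have i1 : Integrable (fun y => γ * inner ℝ p (avg y)) (μ x) := (hai.const_inner p).const_mul γ
  have i2 : Integrable (fun y => V (avg x) + γ * inner ℝ p (avg y)) (μ x) :=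
    (integrable_const _).add i1
  have i3 : Integrable (fun y : Stack N d => K * γ ^ 2 * ‖y‖ ^ 2) (μ x) := hy2.const_mul _
  have h1 : ∫ y, V (avg x + γ • avg y) ∂μ x ≤
      ∫ y, (V (avg x) + γ * inner ℝ p (avg y) + K * γ ^ 2 * ‖y‖ ^ 2) ∂μ x := by
    refine integral_mono_of_nonneg (ae_of_all _ fun y => hV.nonneg _) ?_ (ae_of_all _ fun y => ?_)
    · exact i2.add i3
    · refine (le_add_inner_gradient_add_sq hV.differentiable hK _ _).trans ?_
      rw [real_inner_smul_right, norm_smul, mul_pow, Real.norm_of_nonneg hγ, ← mul_assoc (K : ℝ)]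
      have := norm_avg_le hN y
      simp only
      gcongr
  have h2 : ∫ y, (V (avg x) + γ * inner ℝ p (avg y) + K * γ ^ 2 * ‖y‖ ^ 2) ∂μ x =
      V (avg x) + γ * inner ℝ p (meanField f x) + K * γ ^ 2 * ∫ y, ‖y‖ ^ 2 ∂μ x := by
    rw [integral_add i2 i3, integral_add (integrable_const _) i1, integral_const_mul,
      integral_const_mul, integral_inner hai, ham]
    simp
  have h3 : inner ℝ p (meanField f x) ≤
      -((N : ℝ)⁻¹ * inner ℝ p (∇ (aggregate f) (avg x))) + ‖p‖ * (C₂ * D) := by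
    have : meanField f x = -((N : ℝ)⁻¹ • ∇ (aggregate f) (avg x)) +
        ((N : ℝ)⁻¹ • ∇ (aggregate f) (avg x) - (N : ℝ)⁻¹ • ∑ i, ∇ (f i) (x i)) := by
      rw [meanField]; abel
    rw [this, inner_add_right, inner_neg_right, real_inner_smul_right]
    gcongr
    exact (real_inner_le_norm _ _).trans (by gcongr)
  -- Young's inequality together with `‖∇V‖² ≤ C₁ (1 + V)`; having `C₁' ≥ 1` also covers `D²`.
  have h4 : t * ‖p‖ * D ≤ C₁' * (t ^ 2 * (1 + V (avg x)) + D ^ 2) := by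
    have e1 : ‖p‖ ^ 2 ≤ C₁' * (1 + V (avg x)) :=
      (hC₁ _).trans (mul_le_mul_of_nonneg_right (le_max_left _ _) (by linarith))
    have e2 : t ^ 2 * ‖p‖ ^ 2 ≤ t ^ 2 * (C₁' * (1 + V (avg x))) := by gcongr
    have e3 : D ^ 2 ≤ C₁' * D ^ 2 := le_mul_of_one_le_left (sq_nonneg _) hC₁0
    nlinarith [sq_nonneg (t * ‖p‖ - D), sq_nonneg (t * ‖p‖), sq_nonneg D]
  have h5 : γ * (‖p‖ * (C₂ * D)) ≤ G * C₂ * C₁' * (t ^ 2 * (1 + V (avg x)) + D ^ 2) := by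
    calc γ * (‖p‖ * (C₂ * D)) ≤ G * t * (‖p‖ * (C₂ * D)) := by gcongr
      _ = G * C₂ * (t * ‖p‖ * D) := by ring
      _ ≤ G * C₂ * (C₁' * (t ^ 2 * (1 + V (avg x)) + D ^ 2)) := by gcongr
      _ = _ := by ring
  have h6 : K * γ ^ 2 * ∫ y, ‖y‖ ^ 2 ∂μ x ≤
      K * G ^ 2 * C₂ * (t ^ 2 * (1 + V (avg x)) + D ^ 2) := by
    have e1 : t ^ 2 * D ^ 2 ≤ 1 * D ^ 2 := by
      gcongr
      exact pow_le_one₀ ht ht1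
    have e2 : γ ^ 2 ≤ (G * t) ^ 2 := pow_le_pow_left₀ hγ hγG 2
    calc K * γ ^ 2 * ∫ y, ‖y‖ ^ 2 ∂μ x
        ≤ K * (G * t) ^ 2 * (C₂ * (1 + V (avg x) + D ^ 2)) := by
          have h0 : 0 ≤ ∫ y, ‖y‖ ^ 2 ∂μ x := integral_nonneg fun y => sq_nonneg _
          exact mul_le_mul (mul_le_mul_of_nonneg_left e2 K.2) hy2' h0 (by positivity)
      _ = K * G ^ 2 * C₂ * (t ^ 2 * (1 + V (avg x)) + t ^ 2 * D ^ 2) := by ring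
      _ ≤ K * G ^ 2 * C₂ * (t ^ 2 * (1 + V (avg x)) + D ^ 2) :=
          mul_le_mul_of_nonneg_left (by linarith) (by positivity)
  have h7 := mul_le_mul_of_nonneg_left h3 hγ
  rw [h2] at h1
  linarith

end Drift

/-! ### Square integrability of the iterates. -/

section Moments

variable {Ω : Type*} [mΩ : MeasurableSpace Ω] {P : Measure Ω} {N d : ℕ}
  {f : Fin N → Vec d → ℝ} {μ : Kernel (Stack N d) (Stack N d)}
  {γ : ℕ → ℝ} {W : ℕ → Ω → Matrix (Fin N) (Fin N) ℝ} {Y : ℕ → Ω → Stack N d}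
  {θ₀ : Ω → Stack N d} {V : Vec d → ℝ}

theorem integrable_norm_sq {E : Type*} [NormedAddCommGroup E] {X : Ω → E} (hX : MemLp X 2 P) :
    Integrable (fun ω => ‖X ω‖ ^ 2) P :=
  (memLp_two_iff_integrable_sq_norm hX.1).1 hX

theorem memLp_avg (hN : 1 ≤ N) {X : Ω → Stack N d} (hX : MemLp X 2 P) :
    MemLp (fun ω => avg (X ω)) 2 P :=
  hX.mono (continuous_avg.comp_aestronglyMeasurable hX.1)
    (ae_of_all _ fun _ => norm_avg_le hN _)

theorem memLp_disagreement (hN : 1 ≤ N) {X : Ω → Stack N d} (hX : MemLp X 2 P) :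
    MemLp (fun ω => disagreement (X ω)) 2 P :=
  hX.mono (continuous_disagreement.comp_aestronglyMeasurable hX.1)
    (ae_of_all _ fun _ => norm_disagreement_le hN _)

theorem memLp_blockSum (u : Fin N → ℝ) {X : Ω → Stack N d} (hX : MemLp X 2 P) :
    MemLp (fun ω => blockSum u (X ω)) 2 P := by
  refine MemLp.of_le_mul (c := √(u ⬝ᵥ u)) hX
    ((continuous_blockSum u).comp_aestronglyMeasurable hX.1)
    (ae_of_all _ fun ω => ?_)
  rw [← sq_le_sq₀ (norm_nonneg _) (by positivity), mul_pow,
    Real.sq_sqrt (show 0 ≤ u ⬝ᵥ u from Finset.sum_nonneg fun i _ => mul_self_nonneg _)]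
  exact norm_blockSum_sq_le u _

theorem LyapunovConditions.integrable_comp_avg [IsFiniteMeasure P] {F : Vec d → ℝ} (hN : 1 ≤ N)
    (hV : LyapunovConditions V F) {X : Ω → Stack N d} (hX : MemLp X 2 P) :
    Integrable (fun ω => V (avg (X ω))) P := by
  obtain ⟨A, hA, hVA⟩ := hV.exists_le_quadratic
  have h1 : Integrable (fun ω => A * (1 + ‖X ω‖ ^ 2)) P :=
    ((integrable_const _).add (integrable_norm_sq hX)).const_mul A
  refine h1.mono' ((hV.differentiable.continuous.comp
    continuous_avg).comp_aestronglyMeasurable hX.1) (ae_of_all _ fun ω => ?_)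
  rw [Real.norm_of_nonneg (hV.nonneg _)]
  refine (hVA _).trans ?_
  have := norm_avg_le hN (X ω)
  gcongr

/-- Minkowski's inequality in `L²`, for square roots of second moments. -/
theorem sqrt_integral_norm_add_sq_le {E : Type*} [NormedAddCommGroup E] {A B : Ω → E}
    (hA : MemLp A 2 P) (hB : MemLp B 2 P) :
    √(∫ ω, ‖A ω + B ω‖ ^ 2 ∂P) ≤ √(∫ ω, ‖A ω‖ ^ 2 ∂P) + √(∫ ω, ‖B ω‖ ^ 2 ∂P) := by
  have key : ∀ {Z : Ω → E}, MemLp Z 2 P → (eLpNorm Z 2 P).toReal = √(∫ ω, ‖Z ω‖ ^ 2 ∂P) := by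
    intro Z hZ
    rw [hZ.eLpNorm_eq_integral_rpow_norm (by norm_num) (by norm_num),
      ENNReal.toReal_ofReal (by positivity), Real.sqrt_eq_rpow]
    norm_num
  rw [← key hA, ← key hB, ← key (Z := fun ω => A ω + B ω) (hA.add hB),
    ← ENNReal.toReal_add hA.2.ne hB.2.ne]
  exact ENNReal.toReal_mono (ENNReal.add_ne_top.2 ⟨hA.2.ne, hB.2.ne⟩)
    (eLpNorm_add_le hA.1 hB.1 (by norm_num))

/-- Independence is essential: a product of two `L²` variables is in general only in `L¹`, but for
independent factors the squares are integrable and so is their product. -/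
theorem memLp_gossip {A : Ω → Matrix (Fin N) (Fin N) ℝ} {Z : Ω → Stack N d}
    (hAm : Measurable A) (hA : ∀ i j, MemLp (fun ω => A ω i j) 2 P) (hZm : Measurable Z)
    (hZ : MemLp Z 2 P) (hAZ : IndepFun A Z P) : MemLp (fun ω => gossip (A ω) (Z ω)) 2 P := by
  have hm : Measurable fun ω => gossip (A ω) (Z ω) := measurable_gossip.comp (hAm.prodMk hZm)
  rw [memLp_two_iff_integrable_sq_norm hm.aestronglyMeasurable]
  have h1 : Measurable fun B : Matrix (Fin N) (Fin N) ℝ => ∑ i, ∑ j, B i j ^ 2 :=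
    Finset.measurable_sum _ fun i _ => Finset.measurable_sum _ fun j _ =>
      (measurable_matrix_apply i j).pow_const 2
  have h2 : Measurable fun z : Stack N d => ‖z‖ ^ 2 := by fun_prop
  have h3 : IndepFun (fun ω => ∑ i, ∑ j, A ω i j ^ 2) (fun ω => ‖Z ω‖ ^ 2) P := hAZ.comp h1 h2
  have h4 : Integrable (fun ω => ∑ i, ∑ j, A ω i j ^ 2) P :=
    integrable_finsetSum _ fun i _ => integrable_finsetSum _ fun j _ => (hA i j).integrable_sq
  have h5 : Integrable (fun ω => ‖Z ω‖ ^ 2) P := integrable_norm_sq hZ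
  refine (h3.integrable_mul h4 h5).mono' (hm.norm.pow_const 2).aestronglyMeasurable
    (ae_of_all _ fun ω => ?_)
  rw [Real.norm_of_nonneg (sq_nonneg _)]
  exact norm_gossip_sq_le _ _

theorem continuous_gradient_of_contDiff {F : Vec d → ℝ} (hF : ContDiff ℝ 1 F) :
    Continuous (∇ F) :=
  (InnerProductSpace.toDual ℝ (Vec d)).symm.continuous.comp (hF.continuous_fderiv one_ne_zero)

theorem ObservationModel.continuous_gradient_aggregate (hM : ObservationModel P f μ γ W Y θ₀) :
    Continuous (∇ (aggregate f)) :=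
  continuous_gradient_of_contDiff (ContDiff.sum fun i _ => hM.contDiff i)

theorem ObservationModel.avg_iterates_succ (hM : ObservationModel P f μ γ W Y θ₀) (n : ℕ) :
    ∀ᵐ ω ∂P, avg (iterates γ W Y θ₀ (n + 1) ω) =
      avg (iterates γ W Y θ₀ n ω) + γ (n + 1) • avg (Y (n + 1) ω) := by
  filter_upwards [hM.stochastic (n + 1) (by omega)] with ω hω
  rw [iterates, avg_gossip hω.2, avg_add, avg_smul]

variable [IsProbabilityMeasure P] [IsMarkovKernel μ]

theorem ObservationModel.memLp_observation (hM : ObservationModel P f μ γ W Y θ₀) (hN : 1 ≤ N)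
    {F : Vec d → ℝ} (hV : LyapunovConditions V F) (hGrowth : GrowthConditions f V μ) (n : ℕ)
    (h : MemLp (iterates γ W Y θ₀ n) 2 P) : MemLp (Y (n + 1)) 2 P := by
  have hYm := hM.measurable_Y (n + 1) (by omega)
  obtain ⟨C, hC, hg⟩ := hGrowth.exists_nonneg hV.nonneg
  rw [memLp_two_iff_integrable_sq_norm hYm.aestronglyMeasurable]
  refine ⟨(hYm.norm.pow_const 2).aestronglyMeasurable, ?_⟩
  rw [hasFiniteIntegral_iff_ofReal (ae_of_all _ fun ω => sq_nonneg _)]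
  have h1 : Measurable fun y : Stack N d => ENNReal.ofReal (‖y‖ ^ 2) := by fun_prop
  rw [hM.lintegral_condMean n h1]
  have h2 : Integrable (fun ω => C * (1 + V (avg (iterates γ W Y θ₀ n ω)) +
      ‖disagreement (iterates γ W Y θ₀ n ω)‖ ^ 2)) P :=
    (((integrable_const _).add (hV.integrable_comp_avg hN h)).add
      (integrable_norm_sq (memLp_disagreement hN h))).const_mul C
  refine lt_of_le_of_lt (lintegral_mono fun ω => ?_) h2.lintegral_lt_top
  rw [← ofReal_integral_eq_lintegral_ofReal (hg _).1.1 (ae_of_all _ fun y => sq_nonneg _)]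
  exact ENNReal.ofReal_le_ofReal (hg _).1.2

theorem ObservationModel.memLp_iterates (hM : ObservationModel P f μ γ W Y θ₀) (hN : 1 ≤ N)
    {F : Vec d → ℝ} (hV : LyapunovConditions V F) (hGrowth : GrowthConditions f V μ) (n : ℕ) :
    MemLp (iterates γ W Y θ₀ n) 2 P := by
  induction n with
  | zero => exact hM.squareIntegrable_init
  | succ n ih =>
    have hYm := hM.measurable_Y (n + 1) (by omega)
    have hY := hM.memLp_observation hN hV hGrowth n ih
    refine memLp_gossip (hM.measurable_W (n + 1) (by omega))
      (hM.squareIntegrable_W (n + 1) (by omega))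
      ((hM.measurable_iterates n).add (hYm.const_smul (γ (n + 1))))
      (ih.add (hY.const_smul (γ (n + 1)))) ?_
    have h1 : Measurable fun p : Stack N d × Stack N d => p.1 + γ (n + 1) • p.2 := by fun_prop
    exact (hM.indepFun n).comp measurable_id h1

end Moments

/-! ### Contraction of the disagreement by random gossip. -/

section Contraction

variable {Ω : Type*} [mΩ : MeasurableSpace Ω] {P : Measure Ω} {N d : ℕ}
  {W : ℕ → Ω → Matrix (Fin N) (Fin N) ℝ}

theorem dotProduct_vecMul_self (u : Fin N → ℝ) (A : Matrix (Fin N) (Fin N) ℝ) :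
    (u ᵥ* A) ⬝ᵥ (u ᵥ* A) = ∑ i, ∑ j, u i * ((A * Aᵀ) i j * u j) := by
  have h : (u ᵥ* A) ⬝ᵥ (u ᵥ* A) = u ⬝ᵥ ((A * Aᵀ) *ᵥ u) := by
    rw [← Matrix.mulVec_mulVec, Matrix.dotProduct_mulVec, Matrix.mulVec_transpose]
  rw [h]
  simp only [dotProduct, Matrix.mulVec, Finset.mul_sum]

theorem integrable_mul_transpose {A : Ω → Matrix (Fin N) (Fin N) ℝ}
    (hA : ∀ i j, MemLp (fun ω => A ω i j) 2 P) (i j : Fin N) :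
    Integrable (fun ω => (A ω * (A ω)ᵀ) i j) P := by
  simp only [Matrix.mul_apply, Matrix.transpose_apply]
  exact integrable_finsetSum _ fun k _ => (hA i k).integrable_mul (hA j k)

theorem integrable_dotProduct_vecMul_self {A : Ω → Matrix (Fin N) (Fin N) ℝ}
    (hA : ∀ i j, MemLp (fun ω => A ω i j) 2 P) (u : Fin N → ℝ) :
    Integrable (fun ω => (u ᵥ* A ω) ⬝ᵥ (u ᵥ* A ω)) P := by
  simp only [dotProduct_vecMul_self]
  exact integrable_finsetSum _ fun i _ => integrable_finsetSum _ fun j _ =>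
    ((integrable_mul_transpose hA i j).mul_const _).const_mul _

/-- The quadratic form of `E[W_n W_nᵀ] - 𝟙𝟙ᵀ/N` is bounded by `ρ_n`. -/
theorem integral_dotProduct_vecMul_le_rho [IsProbabilityMeasure P] (n : ℕ)
    (hW : ∀ i j, MemLp (fun ω => W n ω i j) 2 P)
    (u : Fin N → ℝ) :
    ∫ ω, ((u ᵥ* W n ω) ⬝ᵥ (u ᵥ* W n ω) - (N : ℝ)⁻¹ * (∑ i, u i) ^ 2) ∂P ≤
      rho P W n * (u ⬝ᵥ u) := by
  have hH : ((Matrix.of fun i j => ∫ ω, (W n ω * (W n ω)ᵀ) i j ∂P) -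
      (N : ℝ)⁻¹ • (Matrix.of fun _ _ => 1) : Matrix (Fin N) (Fin N) ℝ).IsHermitian := by
    ext i j
    simp [Matrix.mul_apply, mul_comm]
  refine le_trans (le_of_eq ?_) (dotProduct_mulVec_le_spectralRadius hH u)
  rw [integral_sub (integrable_dotProduct_vecMul_self hW u) (integrable_const _),
    Matrix.sub_mulVec, dotProduct_sub]
  congr 1
  · simp only [dotProduct_vecMul_self]
    rw [integral_finsetSum _ fun i _ => integrable_finsetSum _ fun j _ =>
      ((integrable_mul_transpose hW i j).mul_const _).const_mul _]
    simp only [dotProduct, Matrix.mulVec, Matrix.of_apply, Finset.mul_sum]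
    refine Finset.sum_congr rfl fun i _ => ?_
    rw [integral_finsetSum _ fun j _ =>
      ((integrable_mul_transpose hW i j).mul_const _).const_mul _]
    refine Finset.sum_congr rfl fun j _ => ?_
    rw [integral_const_mul, integral_mul_const]
  · simp [dotProduct, Matrix.mulVec, ← Finset.mul_sum, ← Finset.sum_mul, sq]
    ring

/-- Mixing contracts the covariance of the disagreement by the factor `ρ_n`. -/
theorem integral_blockSum_gossip_le [IsProbabilityMeasure P] (hN : 1 ≤ N) (n : ℕ)
    {Z : Ω → Stack N d}
    (hWm : Measurable (W n)) (hW : ∀ i j, MemLp (fun ω => W n ω i j) 2 P)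
    (hst : ∀ᵐ ω ∂P, W n ω *ᵥ 1 = 1 ∧ (W n ω)ᵀ *ᵥ 1 = 1) (hZm : Measurable Z)
    (hZ : MemLp Z 2 P) (hWZ : IndepFun (W n) Z P) {s : ℝ} (hs : 0 ≤ s)
    (hq : ∀ u : Fin N → ℝ, ∫ ω, ‖blockSum u (disagreement (Z ω))‖ ^ 2 ∂P ≤ s * (u ⬝ᵥ u))
    (u : Fin N → ℝ) :
    ∫ ω, ‖blockSum u (disagreement (gossip (W n ω) (Z ω)))‖ ^ 2 ∂P ≤
      s * (rho P W n * (u ⬝ᵥ u)) := by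
  set D : Ω → Stack N d := fun ω => disagreement (Z ω) with hD
  have hDm : Measurable D := continuous_disagreement.measurable.comp hZm
  have hDL : MemLp D 2 P := memLp_disagreement hN hZ
  have hWD : IndepFun (W n) D P := hWZ.comp measurable_id continuous_disagreement.measurable
  set ψ : Matrix (Fin N) (Fin N) ℝ × Stack N d → ℝ :=
    fun p => ‖blockSum u (gossip p.1 p.2)‖ ^ 2 with hψ
  have hψm : Measurable ψ :=
    (((continuous_blockSum u).measurable.comp measurable_gossip).norm).pow_const 2
  have hgL : MemLp (fun ω => gossip (W n ω) (D ω)) 2 P := memLp_gossip hWm hW hDm hDL hWD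
  have hψi : Integrable (fun ω => ψ (W n ω, D ω)) P := integrable_norm_sq (memLp_blockSum u hgL)
  have hmap := (indepFun_iff_map_prod_eq_prod_map_map hWm.aemeasurable hDm.aemeasurable).1 hWD
  have hψi' : Integrable ψ ((P.map (W n)).prod (P.map D)) := by
    rw [← hmap]
    exact (integrable_map_measure hψm.aestronglyMeasurable (hWm.prodMk hDm).aemeasurable).2 hψi
  have h1 : ∫ ω, ‖blockSum u (disagreement (gossip (W n ω) (Z ω)))‖ ^ 2 ∂P =
      ∫ ω, ψ (W n ω, D ω) ∂P := by
    refine integral_congr_ae ?_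
    filter_upwards [hst] with ω hω
    rw [disagreement_gossip hω.1 hω.2]
  have h2 : ∫ ω, ψ (W n ω, D ω) ∂P = ∫ ω, ∫ ω', ψ (W n ω, D ω') ∂P ∂P := by
    rw [← integral_map (f := ψ) (hWm.prodMk hDm).aemeasurable hψm.aestronglyMeasurable, hmap,
      integral_prod _ hψi', integral_map hWm.aemeasurable
        hψi'.integral_prod_left.aestronglyMeasurable]
    refine integral_congr_ae (ae_of_all _ fun ω => ?_)
    exact integral_map hDm.aemeasurable
      (hψm.comp (measurable_const.prodMk measurable_id)).aestronglyMeasurable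
  -- With `W` frozen, gossip moves the test direction from `u` to `w = Wᵀ u`. The blocks of `D` sum
  -- to zero, so `w` may be centred, and its centred square norm is `|w|² - (∑ u_i)²/N` because `W 𝟙
  -- = 𝟙`. Averaging over `W` gives the quadratic form of `E[W Wᵀ] - 𝟙𝟙ᵀ/N` at `u`.
  have h3 : ∀ᵐ ω ∂P, ∫ ω', ψ (W n ω, D ω') ∂P ≤
      s * ((u ᵥ* W n ω) ⬝ᵥ (u ᵥ* W n ω) - (N : ℝ)⁻¹ * (∑ i, u i) ^ 2) := by
    filter_upwards [hst] with ω hω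
    set w := u ᵥ* W n ω with hw
    have hsum : ∑ i, w i = ∑ i, u i := by
      have : w ⬝ᵥ 1 = u ⬝ᵥ 1 := by rw [hw, ← Matrix.dotProduct_mulVec, hω.1]
      simpa [dotProduct] using this
    have h4 := hq (fun j => w j - (N : ℝ)⁻¹ * ∑ i, w i)
    rw [dotProduct_sub_mean hN, hsum] at h4
    refine le_trans (le_of_eq ?_) h4
    refine integral_congr_ae (ae_of_all _ fun ω' => ?_)
    simp only [hψ, hD]
    rw [blockSum_gossip, ← hw, blockSum_sub_const (sum_disagreement hN _)]
  rw [h1, h2]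
  have hi : Integrable (fun ω => (u ᵥ* W n ω) ⬝ᵥ (u ᵥ* W n ω) - (N : ℝ)⁻¹ * (∑ i, u i) ^ 2) P :=
    (integrable_dotProduct_vecMul_self hW u).sub (integrable_const _)
  calc ∫ ω, ∫ ω', ψ (W n ω, D ω') ∂P ∂P
      ≤ ∫ ω, s * ((u ᵥ* W n ω) ⬝ᵥ (u ᵥ* W n ω) - (N : ℝ)⁻¹ * (∑ i, u i) ^ 2) ∂P :=
        integral_mono_of_nonneg
          (ae_of_all _ fun ω => integral_nonneg fun ω' => sq_nonneg _) (hi.const_mul s) h3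
    _ = s * ∫ ω, ((u ᵥ* W n ω) ⬝ᵥ (u ᵥ* W n ω) - (N : ℝ)⁻¹ * (∑ i, u i) ^ 2) ∂P :=
        integral_const_mul _ _
    _ ≤ _ := mul_le_mul_of_nonneg_left (integral_dotProduct_vecMul_le_rho n hW u) hs

theorem integral_norm_sq_le_of_blockSum {X : Ω → Stack N d} (hX : MemLp X 2 P) {s : ℝ}
    (hq : ∀ u : Fin N → ℝ, ∫ ω, ‖blockSum u (X ω)‖ ^ 2 ∂P ≤ s * (u ⬝ᵥ u)) :
    ∫ ω, ‖X ω‖ ^ 2 ∂P ≤ N * s := by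
  simp only [norm_sq_eq_sum_blockSum]
  rw [integral_finsetSum _ fun i _ => integrable_norm_sq (memLp_blockSum _ hX)]
  refine (Finset.sum_le_sum fun i _ => hq (Pi.single i 1)).trans ?_
  simp

/-- Minkowski's inequality keeps the coefficient of `a` equal to one. A fixed factor above one would
defeat the contraction, since `ρ_n` may tend to one. -/
theorem integral_blockSum_disagreement_add_le (hN : 1 ≤ N) {X Y : Ω → Stack N d} (hX : MemLp X 2 P)
    (hY : MemLp Y 2 P) {a g : ℝ} (ha : 0 ≤ a) (hg : 0 ≤ g)
    (hq : ∀ u : Fin N → ℝ, ∫ ω, ‖blockSum u (disagreement (X ω))‖ ^ 2 ∂P ≤ a ^ 2 * (u ⬝ᵥ u))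
    (u : Fin N → ℝ) :
    ∫ ω, ‖blockSum u (disagreement (X ω + g • Y ω))‖ ^ 2 ∂P ≤
      (a + g * √(∫ ω, ‖Y ω‖ ^ 2 ∂P)) ^ 2 * (u ⬝ᵥ u) := by
  have hu : 0 ≤ u ⬝ᵥ u := Finset.sum_nonneg fun i _ => mul_self_nonneg _
  have h1 := sqrt_integral_norm_add_sq_le (memLp_blockSum u (memLp_disagreement hN hX))
    ((memLp_blockSum u (memLp_disagreement hN hY)).const_smul g)
  have h2 : √(∫ ω, ‖blockSum u (disagreement (X ω))‖ ^ 2 ∂P) ≤ a * √(u ⬝ᵥ u) := by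
    rw [← Real.sqrt_sq ha, ← Real.sqrt_mul (sq_nonneg a)]
    exact Real.sqrt_le_sqrt (hq u)
  have h3 : ∫ ω, ‖(g • fun ω => blockSum u (disagreement (Y ω))) ω‖ ^ 2 ∂P ≤
      (g * √(∫ ω, ‖Y ω‖ ^ 2 ∂P) * √(u ⬝ᵥ u)) ^ 2 := by
    have h0 : 0 ≤ ∫ ω, ‖Y ω‖ ^ 2 ∂P := integral_nonneg fun ω => sq_nonneg _
    rw [mul_pow, mul_pow, Real.sq_sqrt h0, Real.sq_sqrt hu, mul_assoc, mul_comm (∫ ω, _ ∂P),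
      ← mul_assoc, ← integral_const_mul]
    refine integral_mono_of_nonneg (ae_of_all _ fun ω => sq_nonneg _)
      ((integrable_norm_sq hY).const_mul _) (ae_of_all _ fun ω => ?_)
    simp only [Pi.smul_apply, norm_smul, mul_pow, Real.norm_of_nonneg hg, mul_assoc]
    have h5 := norm_blockSum_sq_le u (disagreement (Y ω))
    have h6 := norm_disagreement_le hN (Y ω)
    exact mul_le_mul_of_nonneg_left (h5.trans (by gcongr)) (sq_nonneg g)
  have h4 := Real.sqrt_le_sqrt h3
  rw [Real.sqrt_sq (by positivity)] at h4
  have h5 := (h1.trans (add_le_add h2 h4))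
  rw [Real.sqrt_le_left (by positivity)] at h5
  refine le_trans (le_of_eq ?_) (h5.trans (le_of_eq ?_))
  · simp only [disagreement_add, disagreement_smul, blockSum_add, blockSum_smul, Pi.smul_apply]
  · rw [← add_mul, mul_pow, Real.sq_sqrt hu]

end Contraction

/-! ### Recursions for the moments of the algorithm. -/

section ModelRecursion

variable {Ω : Type*} [mΩ : MeasurableSpace Ω] {P : Measure Ω} [IsProbabilityMeasure P] {N d : ℕ}
  {f : Fin N → Vec d → ℝ} {μ : Kernel (Stack N d) (Stack N d)} [IsMarkovKernel μ]
  {γ : ℕ → ℝ} {W : ℕ → Ω → Matrix (Fin N) (Fin N) ℝ} {Y : ℕ → Ω → Stack N d}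
  {θ₀ : Ω → Stack N d} {V : Vec d → ℝ}

theorem ObservationModel.exists_integral_observation_le (hM : ObservationModel P f μ γ W Y θ₀)
    (hN : 1 ≤ N) {F : Vec d → ℝ} (hV : LyapunovConditions V F) (hGrowth : GrowthConditions f V μ) :
    ∃ C, 0 ≤ C ∧ ∀ n, ∫ ω, ‖Y (n + 1) ω‖ ^ 2 ∂P ≤
      C * (1 + ∫ ω, V (avg (iterates γ W Y θ₀ n ω)) ∂P +
        ∫ ω, ‖disagreement (iterates γ W Y θ₀ n ω)‖ ^ 2 ∂P) := by
  obtain ⟨C, hC, hg⟩ := hGrowth.exists_nonneg hV.nonneg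
  refine ⟨C, hC, fun n => ?_⟩
  have hX := hM.memLp_iterates hN hV hGrowth n
  have hY := hM.memLp_observation hN hV hGrowth n hX
  have hψ : StronglyMeasurable fun p : Stack N d × Stack N d => ‖p.2‖ ^ 2 := by
    apply Measurable.stronglyMeasurable
    fun_prop
  obtain ⟨h1, h2⟩ := hM.integrable_condMean n hψ (integrable_norm_sq hY)
  have h3 := h2 Set.univ MeasurableSet.univ
  simp only [Measure.restrict_univ] at h3
  have i1 := hV.integrable_comp_avg hN hX
  have i2 : Integrable (fun ω => 1 + V (avg (iterates γ W Y θ₀ n ω))) P :=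
    (integrable_const _).add i1
  have i3 := integrable_norm_sq (memLp_disagreement hN hX)
  have h4 : ∫ ω, C * (1 + V (avg (iterates γ W Y θ₀ n ω)) +
      ‖disagreement (iterates γ W Y θ₀ n ω)‖ ^ 2) ∂P =
      C * (1 + ∫ ω, V (avg (iterates γ W Y θ₀ n ω)) ∂P +
        ∫ ω, ‖disagreement (iterates γ W Y θ₀ n ω)‖ ^ 2 ∂P) := by
    rw [integral_const_mul, integral_add i2 i3, integral_add (integrable_const _) i1]
    simp
  rw [h3, ← h4]
  exact integral_mono h1 ((i2.add i3).const_mul C) fun ω => (hg _).1.2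

/-- The bound is propagated in all directions `u` at once. The dimensional factor `N` from passing
to the full norm then enters only the forcing constant `√(C N)` and never the contraction factor. -/
theorem ObservationModel.exists_disagreement_recursion (hM : ObservationModel P f μ γ W Y θ₀)
    (hN : 1 ≤ N) {F : Vec d → ℝ} (hV : LyapunovConditions V F) (hGrowth : GrowthConditions f V μ) :
    ∃ C, 0 ≤ C ∧ ∀ n (a : ℝ), 0 ≤ a → 0 ≤ γ (n + 1) →
      (∀ u : Fin N → ℝ, ∫ ω, ‖blockSum u (disagreement (iterates γ W Y θ₀ n ω))‖ ^ 2 ∂P ≤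
        a ^ 2 * (u ⬝ᵥ u)) →
      ∀ u : Fin N → ℝ, ∫ ω, ‖blockSum u (disagreement (iterates γ W Y θ₀ (n + 1) ω))‖ ^ 2 ∂P ≤
        (√(rho P W (n + 1)) * (a + C * γ (n + 1) *
          √(1 + ∫ ω, V (avg (iterates γ W Y θ₀ n ω)) ∂P + a ^ 2))) ^ 2 * (u ⬝ᵥ u) := by
  obtain ⟨C, hC, hYC⟩ := hM.exists_integral_observation_le hN hV hGrowth
  refine ⟨√(C * N), Real.sqrt_nonneg _, fun n a ha hγ hq u => ?_⟩
  have hX := hM.memLp_iterates hN hV hGrowth n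
  have hY := hM.memLp_observation hN hV hGrowth n hX
  have hYm := hM.measurable_Y (n + 1) (by omega)
  have hv : 0 ≤ ∫ ω, V (avg (iterates γ W Y θ₀ n ω)) ∂P := integral_nonneg fun ω => hV.nonneg _
  set v := ∫ ω, V (avg (iterates γ W Y θ₀ n ω)) ∂P
  have hu : 0 ≤ u ⬝ᵥ u := Finset.sum_nonneg fun i _ => mul_self_nonneg _
  have h1 := integral_blockSum_disagreement_add_le hN hX hY ha hγ hq
  have hZi : IndepFun (W (n + 1))
      (fun ω => iterates γ W Y θ₀ n ω + γ (n + 1) • Y (n + 1) ω) P := by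
    have h1 : Measurable fun p : Stack N d × Stack N d => p.1 + γ (n + 1) • p.2 := by fun_prop
    exact (hM.indepFun n).comp measurable_id h1
  have h2 := integral_blockSum_gossip_le hN (n + 1) (hM.measurable_W (n + 1) (by omega))
    (hM.squareIntegrable_W (n + 1) (by omega)) (hM.stochastic (n + 1) (by omega))
    ((hM.measurable_iterates n).add (hYm.const_smul (γ (n + 1))))
    (hX.add (hY.const_smul (γ (n + 1)))) hZi (sq_nonneg _) h1 u
  refine h2.trans ?_
  have hρ : 0 ≤ rho P W (n + 1) := ENNReal.toReal_nonneg
  have h3 : √(∫ ω, ‖Y (n + 1) ω‖ ^ 2 ∂P) ≤ √(C * N) * √(1 + v + a ^ 2) := by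
    rw [← Real.sqrt_mul (by positivity)]
    refine Real.sqrt_le_sqrt ((hYC n).trans ?_)
    have h4 := integral_norm_sq_le_of_blockSum (memLp_disagreement hN hX) hq
    have hN1 : (1 : ℝ) ≤ N := by exact_mod_cast hN
    have h5 : 1 + v ≤ N * (1 + v) := le_mul_of_one_le_left (by linarith) hN1
    rw [mul_assoc]
    exact mul_le_mul_of_nonneg_left (by linarith) hC
  rw [mul_pow, Real.sq_sqrt hρ]
  have h6 : a + γ (n + 1) * √(∫ ω, ‖Y (n + 1) ω‖ ^ 2 ∂P) ≤
      a + √(C * N) * γ (n + 1) * √(1 + v + a ^ 2) := by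
    have := mul_le_mul_of_nonneg_left h3 hγ
    linarith
  have h7 : (a + γ (n + 1) * √(∫ ω, ‖Y (n + 1) ω‖ ^ 2 ∂P)) ^ 2 ≤
      (a + √(C * N) * γ (n + 1) * √(1 + v + a ^ 2)) ^ 2 :=
    pow_le_pow_left₀ (by positivity) h6 2
  calc _ ≤ (a + √(C * N) * γ (n + 1) * √(1 + v + a ^ 2)) ^ 2 * (rho P W (n + 1) * (u ⬝ᵥ u)) :=
        mul_le_mul_of_nonneg_right h7 (by positivity)
    _ = _ := by ring

/-- Conditional drift inequality for `V(⟨θ_n⟩)`, integrated over events of `F_n`. -/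
theorem ObservationModel.exists_setIntegral_drift_le (hM : ObservationModel P f μ γ W Y θ₀)
    (hN : 1 ≤ N) (hV : LyapunovConditions V (aggregate f)) (hGrowth : GrowthConditions f V μ)
    {G : ℝ} (hG : 0 ≤ G) :
    ∃ C, 0 ≤ C ∧ ∀ n (t : ℝ), 0 < γ (n + 1) → γ (n + 1) ≤ G * t → 0 ≤ t → t ≤ 1 →
      Integrable (fun ω => inner ℝ (∇ V (avg (iterates γ W Y θ₀ n ω)))
        (∇ (aggregate f) (avg (iterates γ W Y θ₀ n ω)))) P ∧
      ∀ A, MeasurableSet[history W Y θ₀ n] A →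
        ∫ ω in A, V (avg (iterates γ W Y θ₀ (n + 1) ω)) ∂P ≤
        ∫ ω in A, (V (avg (iterates γ W Y θ₀ n ω)) - γ (n + 1) * ((N : ℝ)⁻¹ *
          inner ℝ (∇ V (avg (iterates γ W Y θ₀ n ω)))
            (∇ (aggregate f) (avg (iterates γ W Y θ₀ n ω)))) +
          C * (t ^ 2 * (1 + V (avg (iterates γ W Y θ₀ n ω))) +
            ‖disagreement (iterates γ W Y θ₀ n ω)‖ ^ 2)) ∂P := by
  obtain ⟨C, hC, hdrift⟩ := hV.exists_drift_le hN hGrowth hM.mean hG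
  refine ⟨C, hC, fun n t hγ hγG ht ht1 => ?_⟩
  have hX := hM.memLp_iterates hN hV hGrowth n
  have hX' := hM.memLp_iterates hN hV hGrowth (n + 1)
  have hXm := hM.measurable_iterates n
  have hNpos : (0 : ℝ) < N := by exact_mod_cast hN
  have hF := hM.continuous_gradient_aggregate
  have iV := hV.integrable_comp_avg hN hX
  have iV' := hV.integrable_comp_avg hN hX'
  have iD := integrable_norm_sq (memLp_disagreement hN hX)
  have hψ : StronglyMeasurable fun p : Stack N d × Stack N d =>
      V (avg p.1 + γ (n + 1) • avg p.2) := by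
    have h1 : Continuous fun p : Stack N d × Stack N d => avg p.1 + γ (n + 1) • avg p.2 :=
      (continuous_avg.comp continuous_fst).add
        ((continuous_avg.comp continuous_snd).const_smul (γ (n + 1)))
    exact (hV.differentiable.continuous.comp h1).stronglyMeasurable
  have hae := hM.avg_iterates_succ n
  have hint : Integrable (fun ω => V (avg (iterates γ W Y θ₀ n ω) +
      γ (n + 1) • avg (Y (n + 1) ω))) P :=
    iV'.congr (hae.mono fun ω hω => by simp only [hω])
  obtain ⟨hci, hcA⟩ := hM.integrable_condMean n hψ hint
  have hd := fun ω => hdrift (iterates γ W Y θ₀ n ω) (γ (n + 1)) t hγ.le hγG ht ht1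
  have iR : Integrable (fun ω => C * (t ^ 2 * (1 + V (avg (iterates γ W Y θ₀ n ω))) +
            ‖disagreement (iterates γ W Y θ₀ n ω)‖ ^ 2)) P :=
    ((((integrable_const _).add iV).const_mul _).add iD).const_mul C
  have ig : Integrable (fun ω => inner ℝ (∇ V (avg (iterates γ W Y θ₀ n ω)))
        (∇ (aggregate f) (avg (iterates γ W Y θ₀ n ω)))) P := by
    -- Integrability is read off the drift inequality itself: its left side is nonnegative, so `γ
    -- ∇V·∇f / N` is at most `V` plus the error term. No growth bound on `∇f` is needed here.
    refine ((iV.add iR).const_mul (N / γ (n + 1))).mono' ?_ (ae_of_all _ fun ω => ?_)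
    · have h1 : Continuous fun x : Stack N d => inner ℝ (∇ V (avg x)) (∇ (aggregate f) (avg x)) :=
        (hV.continuous_gradient.comp continuous_avg).inner (hF.comp continuous_avg)
      exact (h1.measurable.comp hXm).aestronglyMeasurable
    · have h1 := hV.descent (avg (iterates γ W Y θ₀ n ω))
      rw [Real.norm_of_nonneg (by linarith), Pi.add_apply]
      have h2 := hd ω
      have h3 : 0 ≤ ∫ y, V (avg (iterates γ W Y θ₀ n ω) + γ (n + 1) • avg y)
        ∂μ (iterates γ W Y θ₀ n ω) := integral_nonneg fun y => hV.nonneg _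
      rw [div_mul_eq_mul_div, le_div_iff₀ hγ]
      have h4 : γ (n + 1) * ((N : ℝ)⁻¹ * inner ℝ (∇ V (avg (iterates γ W Y θ₀ n ω)))
            (∇ (aggregate f) (avg (iterates γ W Y θ₀ n ω)))) ≤
            V (avg (iterates γ W Y θ₀ n ω)) +
            C * (t ^ 2 * (1 + V (avg (iterates γ W Y θ₀ n ω))) +
            ‖disagreement (iterates γ W Y θ₀ n ω)‖ ^ 2) := by linarith
      have h5 := mul_le_mul_of_nonneg_left h4 hNpos.le
      refine le_trans (le_of_eq ?_) h5
      field_simp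
  refine ⟨ig, fun A hA => ?_⟩
  have h1 : ∫ ω in A, V (avg (iterates γ W Y θ₀ (n + 1) ω)) ∂P =
      ∫ ω in A, V (avg (iterates γ W Y θ₀ n ω) + γ (n + 1) • avg (Y (n + 1) ω)) ∂P :=
    integral_congr_ae (ae_restrict_of_ae (hae.mono fun ω hω => by simp only [hω]))
  rw [h1, hcA A hA]
  exact integral_mono hci.integrableOn
    ((iV.sub ((ig.const_mul _).const_mul _)).add iR).integrableOn hd

end ModelRecursion

/-! ### Almost sure convergence theorems. -/

section AlmostSure

variable {Ω : Type*} [mΩ : MeasurableSpace Ω] {P : Measure Ω}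

theorem ae_summable_of_summable_integral {F : ℕ → Ω → ℝ} (hF : ∀ n, Integrable (F n) P)
    (hF0 : ∀ n ω, 0 ≤ F n ω) (hs : Summable fun n => ∫ ω, F n ω ∂P) :
    ∀ᵐ ω ∂P, Summable fun n => F n ω := by
  have h1 : ∫⁻ ω, ∑' n, ENNReal.ofReal (F n ω) ∂P ≠ ∞ := by
    rw [lintegral_tsum fun n => (hF n).1.aemeasurable.ennreal_ofReal]
    simp only [← ofReal_integral_eq_lintegral_ofReal (hF _) (ae_of_all _ (hF0 _))]
    exact hs.tsum_ofReal_ne_top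
  have h2 := ae_lt_top' (AEMeasurable.tsum fun n => (hF n).1.aemeasurable.ennreal_ofReal) h1
  filter_upwards [h2] with ω hω
  have h3 := ENNReal.summable_toReal hω.ne
  simpa only [ENNReal.toReal_ofReal (hF0 _ ω)] using h3

/-- A nonnegative process whose conditional increments are dominated by an integrable, summable
process converges almost surely. -/
theorem ae_exists_tendsto_of_almost_supermartingale [IsProbabilityMeasure P] {ℱ : Filtration ℕ mΩ}
    {X e : ℕ → Ω → ℝ} (hXm : StronglyAdapted ℱ X) (hem : StronglyAdapted ℱ e)
    (hXi : ∀ n, Integrable (X n) P) (hei : ∀ n, Integrable (e n) P) (hX0 : ∀ n ω, 0 ≤ X n ω)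
    (he0 : ∀ n ω, 0 ≤ e n ω) (hes : Summable fun n => ∫ ω, e n ω ∂P) {K : ℝ}
    (hXK : ∀ n, ∫ ω, X n ω ∂P ≤ K)
    (hstep : ∀ n A, MeasurableSet[ℱ n] A →
      ∫ ω in A, X (n + 1) ω ∂P ≤ ∫ ω in A, (X n ω + e n ω) ∂P) :
    ∀ᵐ ω ∂P, ∃ c, Tendsto (fun n => X n ω) atTop (𝓝 c) := by
  -- Compensating by the errors and changing sign gives an `L¹`-bounded submartingale; the
  -- compensator converges on its own.
  set Z : ℕ → Ω → ℝ := fun n ω => ∑ k ∈ Finset.range n, e k ω - X n ω with hZ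
  have hSi : ∀ n, Integrable (fun ω => ∑ k ∈ Finset.range n, e k ω) P := fun n =>
    integrable_finsetSum _ fun k _ => hei k
  have hZm : StronglyAdapted ℱ Z := by
    intro n
    refine StronglyMeasurable.sub ?_ (hXm n)
    refine Finset.stronglyMeasurable_fun_sum _ fun k hk => ?_
    exact (hem k).mono (ℱ.mono (Finset.mem_range.1 hk).le)
  have hZi : ∀ n, Integrable (Z n) P := fun n => (hSi n).sub (hXi n)
  have hsub : Submartingale Z ℱ P := by
    refine submartingale_of_setIntegral_le_succ hZm hZi fun n A hA => ?_
    have h1 := hstep n A hA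
    rw [integral_add (hXi n).integrableOn (hei n).integrableOn] at h1
    simp only [hZ]
    rw [integral_sub (hSi n).integrableOn (hXi n).integrableOn,
      integral_sub (hSi (n + 1)).integrableOn (hXi (n + 1)).integrableOn]
    simp only [Finset.sum_range_succ]
    rw [integral_add (hSi n).integrableOn (hei n).integrableOn]
    linarith
  have hbdd : ∀ n, eLpNorm (Z n) 1 P ≤ (Real.toNNReal (∑' k, ∫ ω, e k ω ∂P + K) : ℝ≥0) := by
    intro n
    rw [eLpNorm_one_eq_lintegral_enorm, ← ofReal_integral_norm_eq_lintegral_enorm (hZi n)]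
    refine ENNReal.ofReal_le_ofReal ?_
    have h1 : ∫ ω, ‖Z n ω‖ ∂P ≤ ∫ ω, (∑ k ∈ Finset.range n, e k ω + X n ω) ∂P := by
      refine integral_mono (hZi n).norm ((hSi n).add (hXi n)) fun ω => ?_
      refine (norm_sub_le _ _).trans_eq ?_
      rw [Real.norm_of_nonneg (hX0 n ω),
        Real.norm_of_nonneg (Finset.sum_nonneg fun k _ => he0 k ω)]
    rw [integral_add (hSi n) (hXi n), integral_finsetSum _ fun k _ => hei k] at h1
    have h2 := hes.sum_le_tsum (Finset.range n) fun k _ => integral_nonneg (he0 k)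
    linarith [hXK n]
  filter_upwards [hsub.exists_ae_tendsto_of_bdd hbdd,
    ae_summable_of_summable_integral hei he0 hes] with ω ⟨c, hc⟩ hω
  refine ⟨∑' k, e k ω - c, ?_⟩
  have h := hω.hasSum.tendsto_sum_nat.sub hc
  simpa [hZ] using h

/-- Almost sure convergence of a series of square-summable martingale differences. -/
theorem ae_exists_tendsto_sum_of_martingaleDifference [IsProbabilityMeasure P]
    {ℱ : Filtration ℕ mΩ} {ξ : ℕ → Ω → ℝ} (hm : ∀ n, StronglyMeasurable[ℱ (n + 1)] (ξ n))
    (hL : ∀ n, MemLp (ξ n) 2 P) (h0 : ∀ n A, MeasurableSet[ℱ n] A → ∫ ω in A, ξ n ω ∂P = 0)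
    (hs : Summable fun n => ∫ ω, ξ n ω ^ 2 ∂P) :
    ∀ᵐ ω ∂P, ∃ c, Tendsto (fun n => ∑ k ∈ Finset.range n, ξ k ω) atTop (𝓝 c) := by
  set S : ℕ → Ω → ℝ := fun n ω => ∑ k ∈ Finset.range n, ξ k ω with hS
  have hSL : ∀ n, MemLp (S n) 2 P := fun n => memLp_finsetSum _ fun k _ => hL k
  have hSm : StronglyAdapted ℱ S := by
    intro n
    refine Finset.stronglyMeasurable_fun_sum _ fun k hk => ?_
    exact (hm k).mono (ℱ.mono (Finset.mem_range.1 hk))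
  have hSi : ∀ n, Integrable (S n) P := fun n => (hSL n).integrable one_le_two
  have hξi : ∀ n, Integrable (ξ n) P := fun n => (hL n).integrable one_le_two
  have hsucc : ∀ n ω, S (n + 1) ω = S n ω + ξ n ω := fun n ω => Finset.sum_range_succ _ _
  have hmart : Martingale S ℱ P := by
    refine martingale_of_setIntegral_eq_succ hSm hSi fun n A hA => ?_
    simp only [hsucc]
    rw [integral_add (hSi n).integrableOn (hξi n).integrableOn, h0 n A hA, add_zero]
  have hcond : ∀ n, P[ξ n|ℱ n] =ᵐ[P] 0 := by
    intro n
    refine (ae_eq_condExp_of_forall_setIntegral_eq (ℱ.le n) (hξi n)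
      (fun _ _ _ => integrableOn_zero) (fun A hA _ => ?_)
      stronglyMeasurable_zero.aestronglyMeasurable).symm
    rw [h0 n A hA]
    simp
  -- Orthogonality of increments gives `E S_n² = ∑ E ξ_k²`, hence an `L²` bound and, through `|S| ≤
  -- 1 + S²`, an `L¹` bound.
  have horth : ∀ n, ∫ ω, S n ω * ξ n ω ∂P = 0 := by
    intro n
    have h1 : Integrable (S n * ξ n) P := (hSL n).integrable_mul (hL n)
    have h2 := condExp_mul_of_stronglyMeasurable_left (hSm n) h1 (hξi n)
    have h3 : P[S n * ξ n|ℱ n] =ᵐ[P] 0 := by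
      filter_upwards [h2, hcond n] with ω hω hω'
      rw [hω, Pi.mul_apply, hω']
      simp
    calc ∫ ω, S n ω * ξ n ω ∂P = ∫ ω, (P[S n * ξ n|ℱ n]) ω ∂P :=
          (integral_condExp (ℱ.le n)).symm
      _ = 0 := by rw [integral_congr_ae h3]; simp
  have hsq : ∀ n, ∫ ω, S n ω ^ 2 ∂P = ∑ k ∈ Finset.range n, ∫ ω, ξ k ω ^ 2 ∂P := by
    intro n
    induction n with
    | zero => simp [hS]
    | succ n ih =>
      rw [Finset.sum_range_succ, ← ih]
      have h1 : ∀ ω, S (n + 1) ω ^ 2 = S n ω ^ 2 + 2 * (S n ω * ξ n ω) + ξ n ω ^ 2 := by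
        intro ω; rw [hsucc]; ring
      have i1 : Integrable (fun ω => 2 * (S n ω * ξ n ω)) P :=
        ((hSL n).integrable_mul (hL n)).const_mul 2
      have i2 : Integrable (fun ω => S n ω ^ 2 + 2 * (S n ω * ξ n ω)) P :=
        (hSL n).integrable_sq.add i1
      simp only [h1]
      rw [integral_add i2 (hL n).integrable_sq, integral_add (hSL n).integrable_sq i1,
        integral_const_mul, horth]
      ring
  refine hmart.submartingale.exists_ae_tendsto_of_bdd
    (R := Real.toNNReal (1 + ∑' k, ∫ ω, ξ k ω ^ 2 ∂P)) fun n => ?_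
  rw [eLpNorm_one_eq_lintegral_enorm, ← ofReal_integral_norm_eq_lintegral_enorm (hSi n)]
  refine ENNReal.ofReal_le_ofReal ?_
  have h1 : ∫ ω, ‖S n ω‖ ∂P ≤ ∫ ω, (1 + S n ω ^ 2) ∂P := by
    refine integral_mono (hSi n).norm ((integrable_const _).add (hSL n).integrable_sq) fun ω => ?_
    simp only [Real.norm_eq_abs]
    rw [← sq_abs]
    nlinarith [sq_nonneg (|S n ω| - 1), abs_nonneg (S n ω)]
  rw [integral_add (integrable_const _) (hSL n).integrable_sq, hsq] at h1
  have h2 := hs.sum_le_tsum (Finset.range n) fun k _ => integral_nonneg fun ω => sq_nonneg _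
  simp only [integral_const, probReal_univ, smul_eq_mul, one_mul] at h1
  linarith

end AlmostSure

/-! ### Uniform moment bounds. -/

section MomentBounds

variable {Ω : Type*} [mΩ : MeasurableSpace Ω] {P : Measure Ω} [IsProbabilityMeasure P] {N d : ℕ}
  {f : Fin N → Vec d → ℝ} {μ : Kernel (Stack N d) (Stack N d)} [IsMarkovKernel μ]
  {γ : ℕ → ℝ} {W : ℕ → Ω → Matrix (Fin N) (Fin N) ℝ} {Y : ℕ → Ω → Stack N d}
  {θ₀ : Ω → Stack N d} {V : Vec d → ℝ}

theorem StepSizes.exists_eventually_le {ρ : ℕ → ℝ} (h : StepSizes γ ρ) :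
    ∃ α : ℝ, 1 / 2 < α ∧ (∃ G, 0 ≤ G ∧ ∀ n : ℕ, γ (n + 1) ≤ G * ((n : ℝ) + 1) ^ (-α)) ∧
      ∃ c : ℝ, 0 < c ∧ ∀ᶠ n : ℕ in atTop, c * ((n : ℝ) ^ α * γ n) ≤ 1 - ρ n := by
  obtain ⟨α, hα, hlim, hinf⟩ := h.rate
  refine ⟨α, hα, ?_, ?_⟩
  · obtain ⟨G, hG⟩ := hlim.bddAbove_range
    refine ⟨max G 0, le_max_right _ _, fun n => ?_⟩
    have h1 : ((n + 1 : ℕ) : ℝ) ^ α * γ (n + 1) ≤ G := hG ⟨n + 1, rfl⟩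
    push_cast at h1
    have hn : (0 : ℝ) < (n : ℝ) + 1 := by positivity
    have h2 : ((n : ℝ) + 1) ^ (-α) * ((n : ℝ) + 1) ^ α = 1 := by
      rw [← Real.rpow_add hn]; simp
    calc γ (n + 1) = ((n : ℝ) + 1) ^ (-α) * (((n : ℝ) + 1) ^ α * γ (n + 1)) := by
          rw [← mul_assoc, h2, one_mul]
      _ ≤ ((n : ℝ) + 1) ^ (-α) * max G 0 :=
          mul_le_mul_of_nonneg_left (h1.trans (le_max_left _ _)) (by positivity)
      _ = _ := mul_comm _ _
  · obtain ⟨c, hc0, hc⟩ := EReal.lt_iff_exists_real_btwn.1 hinf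
    refine ⟨c, by exact_mod_cast hc0, ?_⟩
    filter_upwards [eventually_lt_of_lt_liminf hc, eventually_ge_atTop 1] with n hn hn1
    have h1 : c < (1 - ρ n) / ((n : ℝ) ^ α * γ n) := by exact_mod_cast hn
    have h2 : (0 : ℝ) < (n : ℝ) ^ α * γ n := by
      have := h.pos n hn1
      positivity
    exact ((lt_div_iff₀ h2).1 h1).le

theorem summable_rpow_neg_sq {α : ℝ} (hα : 1 / 2 < α) :
    Summable fun n : ℕ => (((n : ℝ) + 1) ^ (-α)) ^ 2 := by
  have h := (Real.summable_nat_rpow (p := -(2 * α))).2 (by linarith)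
  refine ((summable_nat_add_iff 1).2 h).congr fun n => ?_
  rw [← Real.rpow_natCast, ← Real.rpow_mul (by positivity)]
  push_cast
  ring_nf

/-- `E V(⟨θ_n⟩)` is bounded and `E|J^⊥ θ_n|²` is square-summably small. -/
theorem ObservationModel.exists_moment_bounds (hM : ObservationModel P f μ γ W Y θ₀)
    (hN : 1 ≤ N) (hStep : StepSizes γ (rho P W)) (hV : LyapunovConditions V (aggregate f))
    (hGrowth : GrowthConditions f V μ) :
    ∃ (t : ℕ → ℝ) (G K : ℝ), 0 ≤ G ∧ (∀ n, 0 ≤ t n ∧ t n ≤ 1) ∧ (Summable fun n => t n ^ 2) ∧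
      (∀ n, γ (n + 1) ≤ G * t n) ∧
      (∀ n, ∫ ω, V (avg (iterates γ W Y θ₀ n ω)) ∂P ≤ K) ∧
      ∀ n, ∫ ω, ‖disagreement (iterates γ W Y θ₀ n ω)‖ ^ 2 ∂P ≤ K * t n ^ 2 := by
  obtain ⟨α, hα, ⟨G, hG, hγG⟩, c, hc, hcρ⟩ := hStep.exists_eventually_le
  have hα0 : 0 < α := by linarith
  obtain ⟨C₁, hC₁, hdis⟩ := hM.exists_disagreement_recursion hN hV hGrowth
  obtain ⟨C₂, hC₂, hdrift⟩ := hM.exists_setIntegral_drift_le hN hV hGrowth hG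
  have hN1 : (1 : ℝ) ≤ N := by exact_mod_cast hN
  -- One constant for both recursions; the factor `N` comes from `E‖J^⊥ θ_n‖² ≤ N a_n²`.
  set C := max C₁ (C₂ * N) with hC
  have hCC₁ : C₁ ≤ C := le_max_left _ _
  have hCC₂ : C₂ * N ≤ C := le_max_right _ _
  have hC0 : 0 ≤ C := hC₁.trans hCC₁
  set v : ℕ → ℝ := fun n => ∫ ω, V (avg (iterates γ W Y θ₀ n ω)) ∂P with hv
  have hv0 : ∀ n, 0 ≤ v n := fun n => integral_nonneg fun ω => hV.nonneg _
  -- The majorant is defined by equality in the recursion; that it dominates every directional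
  -- second moment is then an induction.
  set a : ℕ → ℝ := fun n => Nat.rec (√(∫ ω, ‖disagreement (θ₀ ω)‖ ^ 2 ∂P))
    (fun n a => √(rho P W (n + 1)) * (a + C * γ (n + 1) * √(1 + v n + a ^ 2))) n with ha
  have hasucc : ∀ n, a (n + 1) =
    √(rho P W (n + 1)) * (a n + C * γ (n + 1) * √(1 + v n + a n ^ 2)) := fun n => rfl
  have hγ0 : ∀ n, 0 < γ (n + 1) := fun n => hStep.pos (n + 1) (by omega)
  have ha0 : ∀ n, 0 ≤ a n := by
    intro n
    induction n with
    | zero => exact Real.sqrt_nonneg _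
    | succ n ih =>
      rw [hasucc]
      have := hγ0 n
      positivity
  have hX := hM.memLp_iterates hN hV hGrowth
  have hq : ∀ n (u : Fin N → ℝ),
      ∫ ω, ‖blockSum u (disagreement (iterates γ W Y θ₀ n ω))‖ ^ 2 ∂P ≤ a n ^ 2 * (u ⬝ᵥ u) := by
    intro n
    induction n with
    | zero =>
      intro u
      have h0 : a 0 ^ 2 = ∫ ω, ‖disagreement (θ₀ ω)‖ ^ 2 ∂P :=
        Real.sq_sqrt (integral_nonneg fun ω => sq_nonneg _)
      rw [h0, mul_comm, ← integral_const_mul]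
      exact integral_mono_of_nonneg (ae_of_all _ fun ω => sq_nonneg _)
        ((integrable_norm_sq (memLp_disagreement hN (hX 0))).const_mul _)
        (ae_of_all _ fun ω => norm_blockSum_sq_le u _)
    | succ n ih =>
      intro u
      refine (hdis n (a n) (ha0 n) (hγ0 n).le ih u).trans ?_
      have hu : 0 ≤ u ⬝ᵥ u := Finset.sum_nonneg fun i _ => mul_self_nonneg _
      refine mul_le_mul_of_nonneg_right ?_ hu
      rw [hasucc]
      have h1 := ha0 n
      have h2 := (hγ0 n).le
      refine pow_le_pow_left₀ (by positivity) ?_ 2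
      exact mul_le_mul_of_nonneg_left (add_le_add_right (mul_le_mul_of_nonneg_right
        (mul_le_mul_of_nonneg_right hCC₁ h2) (Real.sqrt_nonneg _)) _) (Real.sqrt_nonneg _)
  have hDa : ∀ n, ∫ ω, ‖disagreement (iterates γ W Y θ₀ n ω)‖ ^ 2 ∂P ≤ N * a n ^ 2 := fun n =>
    integral_norm_sq_le_of_blockSum (memLp_disagreement hN (hX n)) (hq n)
  have ht0 : ∀ n : ℕ, 0 ≤ ((n : ℝ) + 1) ^ (-α) := fun n => by positivity
  have ht1 : ∀ n : ℕ, ((n : ℝ) + 1) ^ (-α) ≤ 1 := fun n =>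
    Real.rpow_le_one_of_one_le_of_nonpos (by linarith [n.cast_nonneg (α := ℝ)]) (by linarith)
  have hrv : ∀ n, v (n + 1) ≤
      v n + C * ((((n : ℝ) + 1) ^ (-α)) ^ 2 * (1 + v n) + a n ^ 2) := by
    intro n
    obtain ⟨-, h2⟩ := hdrift n _ (hγ0 n) (hγG n) (ht0 n) (ht1 n)
    have h3 := h2 Set.univ MeasurableSet.univ
    simp only [Measure.restrict_univ] at h3
    have iV := hV.integrable_comp_avg hN (hX n)
    have iD := integrable_norm_sq (memLp_disagreement hN (hX n))
    set T := (((n : ℝ) + 1) ^ (-α)) ^ 2 with hT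
    have hT0 : 0 ≤ T := sq_nonneg _
    have i1 : Integrable (fun ω => 1 + V (avg (iterates γ W Y θ₀ n ω))) P :=
      (integrable_const _).add iV
    have i2 : Integrable (fun ω => T * (1 + V (avg (iterates γ W Y θ₀ n ω))) +
            ‖disagreement (iterates γ W Y θ₀ n ω)‖ ^ 2) P := (i1.const_mul T).add iD
    have h4 : v (n + 1) ≤ ∫ ω, (V (avg (iterates γ W Y θ₀ n ω)) +
        C₂ * (T * (1 + V (avg (iterates γ W Y θ₀ n ω))) +
            ‖disagreement (iterates γ W Y θ₀ n ω)‖ ^ 2)) ∂P := by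
      obtain ⟨ig, -⟩ := hdrift n _ (hγ0 n) (hγG n) (ht0 n) (ht1 n)
      refine h3.trans (integral_mono ((iV.sub ((ig.const_mul _).const_mul _)).add
        (i2.const_mul C₂)) (iV.add (i2.const_mul C₂)) fun ω => ?_)
      have h5 := hV.descent (avg (iterates γ W Y θ₀ n ω))
      have h6 : 0 ≤ γ (n + 1) * ((N : ℝ)⁻¹ * inner ℝ (∇ V (avg (iterates γ W Y θ₀ n ω)))
            (∇ (aggregate f) (avg (iterates γ W Y θ₀ n ω)))) :=
        mul_nonneg (hγ0 n).le (mul_nonneg (by positivity) (by linarith))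
      simp only
      linarith
    rw [integral_add iV (i2.const_mul C₂), integral_const_mul, integral_add (i1.const_mul T) iD,
      integral_const_mul, integral_add (integrable_const _) iV] at h4
    simp only [integral_const, probReal_univ, smul_eq_mul, one_mul] at h4
    have hvn := hv0 n
    have h7 : C₂ * (T * (1 + v n) + ∫ ω, ‖disagreement (iterates γ W Y θ₀ n ω)‖ ^ 2 ∂P) ≤
        C * (T * (1 + v n) + a n ^ 2) := by
      have e1 : T * (1 + v n) ≤ N * (T * (1 + v n)) :=
        le_mul_of_one_le_left (by positivity) hN1
      calc _ ≤ C₂ * (N * (T * (1 + v n)) + N * a n ^ 2) :=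
            mul_le_mul_of_nonneg_left (add_le_add e1 (hDa n)) hC₂
        _ = C₂ * N * (T * (1 + v n) + a n ^ 2) := by ring
        _ ≤ _ := mul_le_mul_of_nonneg_right hCC₂ (by positivity)
    linarith
  obtain ⟨K, hK⟩ := exists_bound_of_coupled_recursion hα0 ha0 hv0 hγ0
    (fun n => ENNReal.toReal_nonneg) hC0 hc hM.rho_tendsto hcρ (fun n => (hasucc n).le) hrv
    (summable_rpow_neg_sq hα)
  refine ⟨fun n => ((n : ℝ) + 1) ^ (-α), G, max K (N * K ^ 2), hG, fun n => ⟨ht0 n, ht1 n⟩,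
    summable_rpow_neg_sq hα, hγG, fun n => (hK n).1.trans (le_max_left _ _), fun n => ?_⟩
  calc _ ≤ (N : ℝ) * a n ^ 2 := hDa n
    _ ≤ N * (K * ((n : ℝ) + 1) ^ (-α)) ^ 2 := by
        have := ha0 n
        have := (hK n).2
        gcongr
    _ = N * K ^ 2 * (((n : ℝ) + 1) ^ (-α)) ^ 2 := by ring
    _ ≤ _ := mul_le_mul_of_nonneg_right (le_max_right _ _) (sq_nonneg _)

end MomentBounds

/-! ### Stability and convergence of the noise. -/

section Convergence

variable {Ω : Type*} [mΩ : MeasurableSpace Ω] {P : Measure Ω} [IsProbabilityMeasure P] {N d : ℕ}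
  {f : Fin N → Vec d → ℝ} {μ : Kernel (Stack N d) (Stack N d)} [IsMarkovKernel μ]
  {γ : ℕ → ℝ} {W : ℕ → Ω → Matrix (Fin N) (Fin N) ℝ} {Y : ℕ → Ω → Stack N d}
  {θ₀ : Ω → Stack N d} {V : Vec d → ℝ}

theorem continuous_meanField (hf : ∀ i, ContDiff ℝ 1 (f i)) : Continuous (meanField f) := by
  have h1 : Continuous fun x : Stack N d => ∑ i, ∇ (f i) (x i) :=
    continuous_finsetSum _ fun i _ =>
      (continuous_gradient_of_contDiff (hf i)).comp (PiLp.continuous_apply 2 (fun _ => Vec d) i)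
  exact (h1.const_smul (N : ℝ)⁻¹).neg

/-- Jensen's inequality, obtained by integrating `‖m - avg y‖² ≥ 0`. -/
theorem norm_meanField_sq_le (hN : 1 ≤ N)
    (hmean : ∀ (x : Stack N d) (i : Fin N),
      Integrable (fun y : Stack N d => y i) (μ x) ∧ ∫ y, y i ∂(μ x) = -∇ (f i) (x i))
    {x : Stack N d} (hx : Integrable (fun y : Stack N d => ‖y‖ ^ 2) (μ x)) :
    ‖meanField f x‖ ^ 2 ≤ ∫ y, ‖y‖ ^ 2 ∂μ x := by
  obtain ⟨hi, hm⟩ := integral_avg hmean x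
  set m := meanField f x
  have i1 : Integrable (fun y => 2 * inner ℝ m (avg y)) (μ x) := (hi.const_inner m).const_mul 2
  have h1 : ∫ y, (2 * inner ℝ m (avg y) - ‖m‖ ^ 2) ∂μ x ≤ ∫ y, ‖y‖ ^ 2 ∂μ x := by
    refine integral_mono (i1.sub (integrable_const _)) hx fun y => ?_
    have h2 := norm_sub_sq_real m (avg y)
    have h3 := pow_le_pow_left₀ (norm_nonneg _) (norm_avg_le hN y) 2
    have h4 := sq_nonneg ‖m - avg y‖
    simp only
    linarith
  rw [integral_sub i1 (integrable_const _), integral_const_mul, integral_inner hi, hm] at h1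
  simp only [real_inner_self_eq_norm_sq, integral_const, probReal_univ, smul_eq_mul, one_mul] at h1
  linarith

theorem ObservationModel.ae_summable_disagreement_sq (hM : ObservationModel P f μ γ W Y θ₀)
    (hN : 1 ≤ N) (hV : LyapunovConditions V (aggregate f))
    (hGrowth : GrowthConditions f V μ) {t : ℕ → ℝ} {K : ℝ} (ht : Summable fun n => t n ^ 2)
    (hD : ∀ n, ∫ ω, ‖disagreement (iterates γ W Y θ₀ n ω)‖ ^ 2 ∂P ≤ K * t n ^ 2) :
    ∀ᵐ ω ∂P, Summable fun n => ‖disagreement (iterates γ W Y θ₀ n ω)‖ ^ 2 :=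
  ae_summable_of_summable_integral
    (fun n => integrable_norm_sq (memLp_disagreement hN (hM.memLp_iterates hN hV hGrowth n)))
    (fun _ _ => sq_nonneg _)
    ((ht.mul_left K).of_nonneg_of_le (fun _ => integral_nonneg fun _ => sq_nonneg _) hD)

/-- Almost sure stability: `V(⟨θ_n⟩)` converges and `∑ γ_{n+1} ∇V(⟨θ_n⟩)ᵀ∇f(⟨θ_n⟩) < ∞`. -/
theorem ObservationModel.ae_tendsto_lyapunov (hM : ObservationModel P f μ γ W Y θ₀)
    (hN : 1 ≤ N) (hγ : ∀ n, 0 < γ (n + 1)) (hV : LyapunovConditions V (aggregate f))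
    (hGrowth : GrowthConditions f V μ) {t : ℕ → ℝ} {G K : ℝ} (hG : 0 ≤ G)
    (ht01 : ∀ n, 0 ≤ t n ∧ t n ≤ 1) (ht : Summable fun n => t n ^ 2)
    (hγt : ∀ n, γ (n + 1) ≤ G * t n)
    (hVK : ∀ n, ∫ ω, V (avg (iterates γ W Y θ₀ n ω)) ∂P ≤ K)
    (hD : ∀ n, ∫ ω, ‖disagreement (iterates γ W Y θ₀ n ω)‖ ^ 2 ∂P ≤ K * t n ^ 2) :
    (∀ᵐ ω ∂P, ∃ c, Tendsto (fun n => V (avg (iterates γ W Y θ₀ n ω))) atTop (𝓝 c)) ∧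
    ∀ᵐ ω ∂P, Summable fun n => γ (n + 1) * inner ℝ (∇ V (avg (iterates γ W Y θ₀ n ω)))
      (∇ (aggregate f) (avg (iterates γ W Y θ₀ n ω))) := by
  obtain ⟨C, hC, hdrift⟩ := hM.exists_setIntegral_drift_le hN hV hGrowth hG
  have hX := hM.memLp_iterates hN hV hGrowth
  have hXm := fun n => measurable_iterates_history (γ := γ) (W := W) (Y := Y) (θ₀ := θ₀) n
  have hNpos : (0 : ℝ) < N := by exact_mod_cast hN
  set X : ℕ → Ω → ℝ := fun n ω => V (avg (iterates γ W Y θ₀ n ω)) with hXdef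
  set g : ℕ → Ω → ℝ := fun n ω => inner ℝ (∇ V (avg (iterates γ W Y θ₀ n ω)))
      (∇ (aggregate f) (avg (iterates γ W Y θ₀ n ω))) with hg
  have hg0 : ∀ n ω, 0 ≤ g n ω := fun n ω => by
    have := hV.descent (avg (iterates γ W Y θ₀ n ω))
    simp only [hg]
    linarith
  set e : ℕ → Ω → ℝ := fun n ω => C * (t n ^ 2 * (1 + X n ω) +
    ‖disagreement (iterates γ W Y θ₀ n ω)‖ ^ 2) with he
  have hX0 : ∀ n ω, 0 ≤ X n ω := fun n ω => hV.nonneg _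
  have he0 : ∀ n ω, 0 ≤ e n ω := fun n ω => by
    have := hX0 n ω
    simp only [he]
    positivity
  have iX : ∀ n, Integrable (X n) P := fun n => hV.integrable_comp_avg hN (hX n)
  have iX1 : ∀ n, Integrable (fun ω => 1 + X n ω) P := fun n => (integrable_const _).add (iX n)
  have iD := fun n => integrable_norm_sq (memLp_disagreement hN (hX n))
  have ie : ∀ n, Integrable (e n) P := fun n => (((iX1 n).const_mul _).add (iD n)).const_mul C
  have ig : ∀ n, Integrable (g n) P := fun n => (hdrift n _ (hγ n) (hγt n) (ht01 n).1 (ht01 n).2).1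
  have hstep : ∀ n A, MeasurableSet[history W Y θ₀ n] A → ∫ ω in A, X (n + 1) ω ∂P ≤
      ∫ ω in A, (X n ω - γ (n + 1) * ((N : ℝ)⁻¹ * g n ω) + e n ω) ∂P := fun n =>
    (hdrift n _ (hγ n) (hγt n) (ht01 n).1 (ht01 n).2).2
  have hes : Summable fun n => ∫ ω, e n ω ∂P := by
    refine Summable.of_nonneg_of_le (fun n => integral_nonneg (he0 n)) (fun n => ?_)
      (ht.mul_left (C * (1 + K + K)))
    simp only [he]
    rw [integral_const_mul, integral_add ((iX1 n).const_mul _) (iD n), integral_const_mul,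
      integral_add (integrable_const _) (iX n)]
    simp only [integral_const, probReal_univ, smul_eq_mul, one_mul]
    rw [mul_assoc]
    refine mul_le_mul_of_nonneg_left ?_ hC
    have h1 : t n ^ 2 * (1 + ∫ ω, X n ω ∂P) ≤ t n ^ 2 * (1 + K) :=
      mul_le_mul_of_nonneg_left (by linarith [hVK n]) (sq_nonneg _)
    linarith [hD n]
  constructor
  · refine ae_exists_tendsto_of_almost_supermartingale (ℱ := hM.filtration) (X := X) (e := e)
      (fun n => ?_) (fun n => ?_) iX ie hX0 he0 hes hVK fun n A hA => ?_
    · exact ((hV.differentiable.continuous.comp continuous_avg).measurable.comp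
        (hXm n)).stronglyMeasurable
    · have h1 : Continuous fun x : Stack N d =>
          C * (t n ^ 2 * (1 + V (avg x)) + ‖disagreement x‖ ^ 2) := by
        have := hV.differentiable.continuous
        have := continuous_avg (N := N) (d := d)
        have := continuous_disagreement (N := N) (d := d)
        fun_prop
      exact (h1.measurable.comp (hXm n)).stronglyMeasurable
    · refine (hstep n A hA).trans (integral_mono
        (((iX n).sub (((ig n).const_mul _).const_mul _)).add (ie n)).integrableOn
        ((iX n).add (ie n)).integrableOn fun ω => ?_)
      have h1 : 0 ≤ γ (n + 1) * ((N : ℝ)⁻¹ * g n ω) :=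
        mul_nonneg (hγ n).le (mul_nonneg (by positivity) (hg0 n ω))
      simp only
      linarith
  · refine ae_summable_of_summable_integral (fun n => (ig n).const_mul _)
      (fun n ω => mul_nonneg (hγ n).le (hg0 n ω)) ?_
    have h1 : ∀ n, ∫ ω, γ (n + 1) * g n ω ∂P ≤
        N * (∫ ω, X n ω ∂P - ∫ ω, X (n + 1) ω ∂P + ∫ ω, e n ω ∂P) := by
      intro n
      have h2 := hstep n Set.univ MeasurableSet.univ
      simp only [Measure.restrict_univ] at h2
      have i1 : Integrable (fun ω => γ (n + 1) * ((N : ℝ)⁻¹ * g n ω)) P :=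
        ((ig n).const_mul _).const_mul _
      have i2 : Integrable (fun ω => X n ω - γ (n + 1) * ((N : ℝ)⁻¹ * g n ω)) P := (iX n).sub i1
      rw [integral_add i2 (ie n), integral_sub (iX n) i1, integral_const_mul,
        integral_const_mul] at h2
      rw [integral_const_mul, ← inv_mul_le_iff₀ hNpos]
      linarith
    -- The expected Lyapunov values telescope, and the last one is dropped by nonnegativity.
    refine summable_of_sum_range_le (c := N * (∫ ω, X 0 ω ∂P + ∑' n, ∫ ω, e n ω ∂P))
      (fun n => integral_nonneg fun ω => mul_nonneg (hγ n).le (hg0 n ω)) fun n => ?_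
    refine (Finset.sum_le_sum fun k _ => h1 k).trans ?_
    rw [← Finset.mul_sum, Finset.sum_add_distrib, Finset.sum_range_sub' (fun n => ∫ ω, X n ω ∂P)]
    refine mul_le_mul_of_nonneg_left ?_ hNpos.le
    have h2 := hes.sum_le_tsum (Finset.range n) fun k _ => integral_nonneg (he0 k)
    have h3 : 0 ≤ ∫ ω, X n ω ∂P := integral_nonneg (hX0 n)
    linarith

/-- The martingale part of the averaged observation noise has convergent weighted sums. -/
theorem ObservationModel.ae_cauchySeq_martingale_noise (hM : ObservationModel P f μ γ W Y θ₀)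
    (hN : 1 ≤ N) (hγ : ∀ n, 0 < γ (n + 1)) (hV : LyapunovConditions V (aggregate f))
    (hGrowth : GrowthConditions f V μ) {t : ℕ → ℝ} {G K : ℝ}
    (ht01 : ∀ n, 0 ≤ t n ∧ t n ≤ 1) (ht : Summable fun n => t n ^ 2)
    (hγt : ∀ n, γ (n + 1) ≤ G * t n)
    (hVK : ∀ n, ∫ ω, V (avg (iterates γ W Y θ₀ n ω)) ∂P ≤ K)
    (hD : ∀ n, ∫ ω, ‖disagreement (iterates γ W Y θ₀ n ω)‖ ^ 2 ∂P ≤ K * t n ^ 2) :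
    ∀ᵐ ω ∂P, CauchySeq fun n => ∑ k ∈ Finset.range n,
      γ (k + 1) • (avg (Y (k + 1) ω) - meanField f (iterates γ W Y θ₀ k ω)) := by
  have hX := hM.memLp_iterates hN hV hGrowth
  have hY := fun n => hM.memLp_observation hN hV hGrowth n (hX n)
  obtain ⟨C₀, hC₀, hg⟩ := hGrowth.exists_nonneg hV.nonneg
  obtain ⟨C, hC, hYC⟩ := hM.exists_integral_observation_le hN hV hGrowth
  have hmc := continuous_meanField hM.contDiff
  set ξ : ℕ → Ω → Vec d := fun n ω =>
    γ (n + 1) • (avg (Y (n + 1) ω) - meanField f (iterates γ W Y θ₀ n ω)) with hξ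
  have hψ2 : StronglyMeasurable fun p : Stack N d × Stack N d => ‖p.2‖ ^ 2 := by
    apply Measurable.stronglyMeasurable
    fun_prop
  have hcond := fun n => hM.integrable_condMean n hψ2 (integrable_norm_sq (hY n))
  have hmsq : ∀ n ω, ‖meanField f (iterates γ W Y θ₀ n ω)‖ ^ 2 ≤
      ∫ y, ‖y‖ ^ 2 ∂μ (iterates γ W Y θ₀ n ω) := fun n ω =>
    norm_meanField_sq_le hN hM.mean (hg _).1.1
  have hmm : ∀ n, AEStronglyMeasurable (fun ω => meanField f (iterates γ W Y θ₀ n ω)) P :=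
    fun n => (hmc.measurable.comp (hM.measurable_iterates n)).aestronglyMeasurable
  have hmi : ∀ n, Integrable (fun ω => ‖meanField f (iterates γ W Y θ₀ n ω)‖ ^ 2) P := fun n =>
    (hcond n).1.mono' ((hmm n).norm.pow 2) (ae_of_all _ fun ω => by
      rw [Real.norm_of_nonneg (sq_nonneg _)]
      exact hmsq n ω)
  have hmL : ∀ n, MemLp (fun ω => meanField f (iterates γ W Y θ₀ n ω)) 2 P := fun n =>
    (memLp_two_iff_integrable_sq_norm (hmm n)).2 (hmi n)
  have haL := fun n => memLp_avg hN (hY n)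
  have hξL : ∀ n, MemLp (ξ n) 2 P := fun n => ((haL n).sub (hmL n)).const_smul (γ (n + 1))
  -- The 4 comes from `‖p - q‖² ≤ 2‖p‖² + 2‖q‖²`, both terms being bounded through `E‖Y‖²`.
  have hξ2 : ∀ n, ∫ ω, ‖ξ n ω‖ ^ 2 ∂P ≤ 4 * G ^ 2 * (C * (1 + K + |K|)) * t n ^ 2 := by
    intro n
    have h1 : ∫ ω, ‖meanField f (iterates γ W Y θ₀ n ω)‖ ^ 2 ∂P ≤
        ∫ ω, ‖Y (n + 1) ω‖ ^ 2 ∂P := by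
      have h2 := (hcond n).2 Set.univ MeasurableSet.univ
      simp only [Measure.restrict_univ] at h2
      rw [h2]
      exact integral_mono (hmi n) (hcond n).1 (hmsq n)
    have h2 : ∫ ω, ‖ξ n ω‖ ^ 2 ∂P ≤ ∫ ω, γ (n + 1) ^ 2 * (2 * (‖Y (n + 1) ω‖ ^ 2 +
        ‖meanField f (iterates γ W Y θ₀ n ω)‖ ^ 2)) ∂P := by
      refine integral_mono (integrable_norm_sq (hξL n))
        ((((integrable_norm_sq (hY n)).add (hmi n)).const_mul 2).const_mul _) fun ω => ?_
      simp only [hξ, norm_smul, mul_pow, Real.norm_of_nonneg (hγ n).le]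
      refine mul_le_mul_of_nonneg_left ?_ (sq_nonneg _)
      have h3 := norm_sub_le (avg (Y (n + 1) ω)) (meanField f (iterates γ W Y θ₀ n ω))
      have h4 := norm_avg_le hN (Y (n + 1) ω)
      have h5 := pow_le_pow_left₀ (norm_nonneg _) (h3.trans (add_le_add_left h4 _)) 2
      nlinarith [sq_nonneg (‖Y (n + 1) ω‖ - ‖meanField f (iterates γ W Y θ₀ n ω)‖)]
    rw [integral_const_mul, integral_const_mul,
      integral_add (integrable_norm_sq (hY n)) (hmi n)] at h2
    have hK : K * t n ^ 2 ≤ |K| := by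
      have h3 : t n ^ 2 ≤ 1 := pow_le_one₀ (ht01 n).1 (ht01 n).2
      calc K * t n ^ 2 ≤ |K| * t n ^ 2 := mul_le_mul_of_nonneg_right (le_abs_self _) (sq_nonneg _)
        _ ≤ |K| := mul_le_of_le_one_right (abs_nonneg _) h3
    have h3 : ∫ ω, ‖Y (n + 1) ω‖ ^ 2 ∂P ≤ C * (1 + K + |K|) :=
      (hYC n).trans (mul_le_mul_of_nonneg_left (by linarith [hVK n, hD n]) hC)
    have h4 : 0 ≤ ∫ ω, ‖Y (n + 1) ω‖ ^ 2 ∂P := integral_nonneg fun ω => sq_nonneg _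
    have h5 : γ (n + 1) ^ 2 ≤ (G * t n) ^ 2 := pow_le_pow_left₀ (hγ n).le (hγt n) 2
    calc _ ≤ γ (n + 1) ^ 2 * (2 * (C * (1 + K + |K|) + C * (1 + K + |K|))) :=
          h2.trans (mul_le_mul_of_nonneg_left (by linarith) (sq_nonneg _))
      _ ≤ (G * t n) ^ 2 * (2 * (C * (1 + K + |K|) + C * (1 + K + |K|))) :=
          mul_le_mul_of_nonneg_right h5 (by linarith)
      _ = _ := by ring
  have hξ0 : ∀ n A, MeasurableSet[history W Y θ₀ n] A → ∫ ω in A, ξ n ω ∂P = 0 := by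
    intro n A hA
    have hψ : StronglyMeasurable fun p : Stack N d × Stack N d => avg p.2 :=
      (continuous_avg.comp continuous_snd).stronglyMeasurable
    have hai := (haL n).integrable one_le_two
    have h1 := (hM.integrable_condMean n hψ hai).2 A hA
    simp only [(integral_avg hM.mean _).2] at h1
    simp only [hξ]
    rw [integral_smul, integral_sub hai.integrableOn
      ((hmL n).integrable one_le_two).integrableOn, h1, sub_self, smul_zero]
  have hξm : ∀ n, Measurable[history W Y θ₀ (n + 1)] (ξ n) := by
    intro n
    have h1 : Measurable[history W Y θ₀ (n + 1)] fun ω => avg (Y (n + 1) ω) :=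
      continuous_avg.measurable.comp (measurable_observation_history n)
    have h2 : Measurable[history W Y θ₀ (n + 1)]
        fun ω => meanField f (iterates γ W Y θ₀ n ω) :=
      hmc.measurable.comp ((measurable_iterates_history n).mono (history_mono n.le_succ) le_rfl)
    exact (h1.sub h2).const_smul (γ (n + 1))
  -- The scalar martingale theorem is applied to each of the finitely many coordinates.
  have hcoord : ∀ j : Fin d, ∀ᵐ ω ∂P, ∃ c,
      Tendsto (fun n => ∑ k ∈ Finset.range n, ξ k ω j) atTop (𝓝 c) := by
    intro j
    have hjc : Continuous fun x : Vec d => x j := PiLp.continuous_apply 2 _ j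
    have hjL : ∀ n, MemLp (fun ω => ξ n ω j) 2 P := fun n =>
      (hξL n).mono (hjc.comp_aestronglyMeasurable (hξL n).1)
        (ae_of_all _ fun ω => PiLp.norm_apply_le (ξ n ω) j)
    refine ae_exists_tendsto_sum_of_martingaleDifference (ℱ := hM.filtration)
      (fun n => (hjc.measurable.comp (hξm n)).stronglyMeasurable) hjL (fun n A hA => ?_) ?_
    · have h1 := (EuclideanSpace.proj (𝕜 := ℝ) j).integral_comp_comm
        (((hξL n).integrable one_le_two).integrableOn (s := A))
      rw [hξ0 n A hA, map_zero] at h1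
      exact h1
    · refine Summable.of_nonneg_of_le (fun n => integral_nonneg fun ω => sq_nonneg _)
        (fun n => ?_) (ht.mul_left (4 * G ^ 2 * (C * (1 + K + |K|))))
      refine le_trans (integral_mono (hjL n).integrable_sq (integrable_norm_sq (hξL n))
        fun ω => ?_) (hξ2 n)
      have h1 := PiLp.norm_apply_le (ξ n ω) j
      rw [Real.norm_eq_abs] at h1
      simp only
      rw [← sq_abs]
      exact pow_le_pow_left₀ (abs_nonneg _) h1 2
  filter_upwards [ae_all_iff.2 hcoord] with ω hω
  choose c hc using hω
  have h1 : Tendsto (fun n => WithLp.ofLp (∑ k ∈ Finset.range n, ξ k ω)) atTop (𝓝 c) := by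
    rw [tendsto_pi_nhds]
    intro j
    simpa using hc j
  have h2 := ((PiLp.continuous_toLp 2 (fun _ : Fin d => ℝ)).tendsto c).comp h1
  exact Tendsto.cauchySeq h2

end Convergence

/-! ### From averages to stacked vectors. -/

section Pathwise

variable {N d : ℕ}

/-- Stacked vectors whose disagreement vanishes and whose averages accumulate in `L` approach
`𝟙 ⊗ L`. -/
theorem tendsto_infEDist_consensus {x : ℕ → Stack N d} {K L : Set (Vec d)} (hK : IsCompact K)
    (hx : ∀ n, avg (x n) ∈ K) (hD : Tendsto (fun n => disagreement (x n)) atTop (𝓝 0))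
    (hL : ∀ p, MapClusterPt p atTop (fun n => avg (x n)) → p ∈ L) :
    Tendsto (fun n => Metric.infEDist (x n) (consensus N '' L)) atTop (𝓝 0) := by
  have hcc : Continuous (consensus N : Vec d → Stack N d) := by
    unfold consensus
    fun_prop
  obtain ⟨B, hB⟩ := (Metric.isBounded_range_of_tendsto _ hD).exists_norm_le
  obtain ⟨B', hB'⟩ := (hK.image hcc).isBounded.exists_norm_le
  have hball : ∀ n, x n ∈ Metric.closedBall (0 : Stack N d) (B + B') := by
    intro n
    rw [mem_closedBall_zero_iff]
    have h1 : x n = disagreement (x n) + consensus N (avg (x n)) := by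
      rw [disagreement, sub_add_cancel]
    rw [h1]
    exact (norm_add_le _ _).trans
      (add_le_add (hB _ ⟨n, rfl⟩) (hB' _ (Set.mem_image_of_mem _ (hx n))))
  -- A cluster point `p` has zero disagreement by continuity, so `p = 𝟙 ⊗ ⟨p⟩`, and `⟨p⟩` is a
  -- cluster point of the averages.
  refine tendsto_infEDist_of_mapClusterPt (isCompact_closedBall _ _) hball fun p hp => ?_
  have h1 : MapClusterPt (avg p) atTop (fun n => avg (x n)) :=
    hp.continuousAt_comp continuous_avg.continuousAt
  have h2 : MapClusterPt (disagreement p) atTop (fun n => disagreement (x n)) :=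
    hp.continuousAt_comp continuous_disagreement.continuousAt
  have h3 : disagreement p = 0 := by
    have h4 : ClusterPt (disagreement p) (𝓝 0) := ClusterPt.mono h2 hD
    exact eq_of_nhds_neBot h4
  exact ⟨avg p, hL _ h1, (sub_eq_zero.1 h3).symm⟩

end Pathwise

/-! ### Assembly along almost every path. -/

section Limit

variable {Ω : Type*} [mΩ : MeasurableSpace Ω] {P : Measure Ω} [IsProbabilityMeasure P] {N d : ℕ}
  {f : Fin N → Vec d → ℝ} {μ : Kernel (Stack N d) (Stack N d)} [IsMarkovKernel μ]
  {γ : ℕ → ℝ} {W : ℕ → Ω → Matrix (Fin N) (Fin N) ℝ} {Y : ℕ → Ω → Stack N d}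
  {θ₀ : Ω → Stack N d} {V : Vec d → ℝ}

/-- Almost surely the averages stay in a compact set, accumulate only in the critical set and have
vanishing increments, and the disagreement tends to zero. -/
theorem ObservationModel.ae_avg_precompact_of_stepSizes (hModel : ObservationModel P f μ γ W Y θ₀)
    (hN : 1 ≤ N) (hStep : StepSizes γ (rho P W)) (hV : LyapunovConditions V (aggregate f))
    (hGrowth : GrowthConditions f V μ) :
    ∀ᵐ ω ∂P, ∃ S : Set (Vec d), IsCompact S ∧
      (∀ n, avg (iterates γ W Y θ₀ n ω) ∈ S) ∧
      (∀ p, MapClusterPt p atTop (fun n => avg (iterates γ W Y θ₀ n ω)) →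
        p ∈ criticalSet V (aggregate f)) ∧
      Tendsto (fun n => dist (avg (iterates γ W Y θ₀ n ω))
        (avg (iterates γ W Y θ₀ (n + 1) ω))) atTop (𝓝 0) ∧
      Tendsto (fun n => disagreement (iterates γ W Y θ₀ n ω)) atTop (𝓝 0) := by
  obtain ⟨t, G, K, hG, ht01, ht, hγt, hVK, hD⟩ :=
    hModel.exists_moment_bounds hN hStep hV hGrowth
  obtain ⟨C, hC, hg⟩ := hGrowth.exists_nonneg hV.nonneg
  have hγ : ∀ n, 0 < γ (n + 1) := fun n => hStep.pos (n + 1) (by omega)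
  obtain ⟨hlim, hgsum⟩ := hModel.ae_tendsto_lyapunov hN hγ hV hGrowth hG ht01 ht hγt hVK hD
  have hDsum := hModel.ae_summable_disagreement_sq hN hV hGrowth ht hD
  have hnoise := hModel.ae_cauchySeq_martingale_noise hN hγ hV hGrowth ht01 ht hγt hVK hD
  have hFc := hModel.continuous_gradient_aggregate
  have hgc : Continuous fun θ => inner ℝ (∇ V θ) (∇ (aggregate f) θ) :=
    hV.continuous_gradient.inner hFc
  have hγsum : Tendsto (fun n => ∑ k ∈ Finset.range n, γ (k + 1)) atTop atTop := by
    refine hStep.sum_tendsto.congr fun n => ?_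
    rw [Finset.range_eq_Ico, Finset.sum_Ico_add' γ 0 n 1, zero_add, Finset.Ico_add_one_right_eq_Icc]
  have hγ0 : Tendsto (fun n => γ (n + 1)) atTop (𝓝 0) := by
    have h1 : Tendsto t atTop (𝓝 0) := by
      have := ht.tendsto_atTop_zero.sqrt
      simpa [Real.sqrt_sq (ht01 _).1] using this
    have h2 := h1.const_mul G
    rw [mul_zero] at h2
    exact squeeze_zero (fun n => (hγ n).le) hγt h2
  filter_upwards [hlim, hgsum, hDsum, hnoise,
    ae_all_iff.2 fun n => hModel.avg_iterates_succ n] with ω ⟨c, hc⟩ hgs hDs hns hsucc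
  obtain ⟨M, hM⟩ := hc.bddAbove_range
  have hS := hV.isCompact_sublevel (max M 1) (by positivity)
  have hmem : ∀ n, avg (iterates γ W Y θ₀ n ω) ∈ {θ | V θ ≤ max M 1} := fun n =>
    (hM ⟨n, rfl⟩).trans (le_max_left _ _)
  set x : ℕ → Vec d := fun n => avg (iterates γ W Y θ₀ n ω) with hx
  set h : Vec d → Vec d := fun θ => -((N : ℝ)⁻¹ • ∇ (aggregate f) θ) with hh
  have hhc : Continuous h := (hFc.const_smul (N : ℝ)⁻¹).neg
  -- The perturbation `δ` splits into martingale noise and this bias from disagreement. The bias is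
  -- summable because its norm is `O(t_n ‖J^⊥ θ_n‖)` and both factors are square summable.
  set b : ℕ → Vec d := fun n => γ (n + 1) • (meanField f (iterates γ W Y θ₀ n ω) - h (x n))
    with hb
  set δ : ℕ → Vec d := fun n => γ (n + 1) • (avg (Y (n + 1) ω) - h (x n)) with hδ
  have hbs : Summable b := by
    refine Summable.of_norm_bounded (g := fun n => G * C *
      (t n ^ 2 + ‖disagreement (iterates γ W Y θ₀ n ω)‖ ^ 2)) ((ht.add hDs).mul_left _) fun n => ?_
    have h1 : ‖meanField f (iterates γ W Y θ₀ n ω) - h (x n)‖ ≤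
        C * ‖disagreement (iterates γ W Y θ₀ n ω)‖ := by
      refine le_trans (le_of_eq ?_) (hg (iterates γ W Y θ₀ n ω)).2
      congr 1
      simp only [meanField, hh, hx]
      abel
    simp only [hb]
    rw [norm_smul, Real.norm_of_nonneg (hγ n).le]
    have ht0 := (ht01 n).1
    calc _ ≤ G * t n * (C * ‖disagreement (iterates γ W Y θ₀ n ω)‖) :=
          mul_le_mul (hγt n) h1 (norm_nonneg _) (by positivity)
      _ = G * C * (t n * ‖disagreement (iterates γ W Y θ₀ n ω)‖) := by ring
      _ ≤ _ := by
        refine mul_le_mul_of_nonneg_left ?_ (by positivity)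
        nlinarith [sq_nonneg (t n - ‖disagreement (iterates γ W Y θ₀ n ω)‖),
          sq_nonneg (t n), sq_nonneg ‖disagreement (iterates γ W Y θ₀ n ω)‖]
  have hδc : CauchySeq fun n => ∑ k ∈ Finset.range n, δ k := by
    have h1 := hns.add hbs.hasSum.tendsto_sum_nat.cauchySeq
    convert h1 using 2 with n
    simp only [Pi.add_apply, ← Finset.sum_add_distrib]
    refine Finset.sum_congr rfl fun k _ => ?_
    simp only [hδ, hb, ← smul_add]
    congr 1
    abel
  have hstep : ∀ n, x (n + 1) = x n + γ (n + 1) • h (x n) + δ n := by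
    intro n
    simp only [hx, hδ, hsucc n]
    rw [add_assoc, ← smul_add, add_sub_cancel]
  have hg0 := tendsto_zero_of_summable_along_scheme (γ := fun n => γ (n + 1)) hstep hγ hγsum hδc
    hhc hgc (fun θ => by have := hV.descent θ; linarith) hgs hS hmem
  refine ⟨_, hS, hmem, fun p hp => ?_, ?_, ?_⟩
  -- The value of `∇V·∇f` at `p` is a cluster value of a sequence tending to zero.
  · have h2 := hp.continuousAt_comp (f := fun θ => inner ℝ (∇ V θ) (∇ (aggregate f) θ))
      hgc.continuousAt
    exact eq_of_nhds_neBot (ClusterPt.mono h2 hg0)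
  · obtain ⟨H, hH⟩ := hS.exists_bound_of_continuousOn hhc.continuousOn
    obtain ⟨l, hl⟩ := cauchySeq_tendsto_of_complete hδc
    have h1 : Tendsto δ atTop (𝓝 0) := by
      have := (hl.comp (tendsto_add_atTop_nat 1)).sub hl
      simpa [Function.comp_def, Finset.sum_range_succ] using this
    have h2 : Tendsto (fun n => γ (n + 1) * H + ‖δ n‖) atTop (𝓝 0) := by
      simpa using (hγ0.mul_const H).add h1.norm
    refine squeeze_zero (fun n => dist_nonneg) (fun n => ?_) h2
    have h3 : x n - x (n + 1) = -(γ (n + 1) • h (x n) + δ n) := by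
      rw [hstep]; abel
    rw [dist_eq_norm, h3, norm_neg]
    refine (norm_add_le _ _).trans (add_le_add_left ?_ _)
    rw [norm_smul, Real.norm_of_nonneg (hγ n).le]
    exact mul_le_mul_of_nonneg_left (hH _ (hmem n)) (hγ n).le
  · have h1 := hDs.tendsto_atTop_zero.sqrt
    rw [tendsto_zero_iff_norm_tendsto_zero]
    simpa [Real.sqrt_sq (norm_nonneg _)] using h1

end Limit
end DistributedSA

theorem theorem1 {Ω : Type*} [MeasurableSpace Ω] (P : Measure Ω) [IsProbabilityMeasure P]
    {N d : ℕ} (hN : 1 ≤ N)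
    (f : Fin N → DistributedSA.Vec d → ℝ)
    (μ : Kernel (DistributedSA.Stack N d) (DistributedSA.Stack N d)) [IsMarkovKernel μ]
    (γ : ℕ → ℝ)
    (W : ℕ → Ω → Matrix (Fin N) (Fin N) ℝ)
    (Y : ℕ → Ω → DistributedSA.Stack N d)
    (θ₀ : Ω → DistributedSA.Stack N d)
    (V : DistributedSA.Vec d → ℝ)
    (hModel : DistributedSA.ObservationModel P f μ γ W Y θ₀)
    (hStep : DistributedSA.StepSizes γ (DistributedSA.rho P W))
    (hV : DistributedSA.LyapunovConditions V (DistributedSA.aggregate f))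
    (hGrowth : DistributedSA.GrowthConditions f V μ) :
    (∀ᵐ ω ∂P, Tendsto
      (fun n => Metric.infEDist (DistributedSA.iterates γ W Y θ₀ n ω)
        (DistributedSA.consensus N ''
          DistributedSA.criticalSet V (DistributedSA.aggregate f)))
      atTop (𝓝 0)) ∧
    (∀ᵐ ω ∂P, ∃ θ ∈ DistributedSA.criticalSet V (DistributedSA.aggregate f),
      Tendsto
        (fun n => Metric.infEDist (DistributedSA.avg (DistributedSA.iterates γ W Y θ₀ n ω))
          (connectedComponentIn
            (DistributedSA.criticalSet V (DistributedSA.aggregate f)) θ))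
        atTop (𝓝 0)) := by
  have key := hModel.ae_avg_precompact_of_stepSizes hN hStep hV hGrowth
  constructor
  · filter_upwards [key] with ω ⟨S, hS, hmem, hcl, _, hD⟩
    exact DistributedSA.tendsto_infEDist_consensus hS hmem hD hcl
  · filter_upwards [key] with ω ⟨S, hS, hmem, hcl, hdist, _⟩
    exact DistributedSA.exists_connectedComponentIn_tendsto hS hmem hdist hcl
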